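/- Let $1<p<\infty$, $\alpha\in\mathbb R$ and $I=(-1,1)$. For $V\in C(\overline I)$ consider the Robin eigenvalue problem $$-\big(|u'|^{p-2}u'\big)'+V|u|^{p-2}u=\lambda|u|^{p-2}u\ \text{ on } I,\qquad |u'|^{p-2}u'=\mp\alpha|u|^{p-2}u\ \text{ at } x=\pm1 ,$$ where $u\in W^{1,p}(I)$, $u\neq0$, and the problem is understood weakly: $$\int_I |u'|^{p-2}u'\xi'+(V-\lambda)|u|^{p-2}u\,\xi\,dx+\alpha\Big[(|u|^{p-2}u\,\xi)(1)+(|u|^{p-2}u\,\xi)(-1)\Big]=0\quad\text{for all }\xi\in C^1(\overline I).$$ For $u\in W^{1,p}(I)\setminus\{0\}$ let $$\mathcal R[u]=\frac{\int_I |u'|^p+V|u|^p\,dx+\alpha\big[|u(1)|^p+|u(-1)|^p\big]}{\int_I|u|^p\,dx},$$ and for $i=0,1,2,\dots$ let $$\lambda_i^V=\inf_{A\in\mathcal A_i}\max_{u\in A}\mathcal R[u],$$ where $\mathcal A_i$ is the family of compact sets $A=-A\subset W^{1,p}(I)\setminus\{0\}$ of Krasnoselskii genus at least $i+1$ (the genus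 of $A$ is the least $n\ge0$ for which there is a continuous odd map $A\to\mathbb R^n\setminus\{0\}$, and $\infty$ if there is none). Let $\Gamma_p(V)=\lambda_1^V-\lambda_0^V$ be the fundamental gap. Let $V\in C(\overline I)$ be symmetric, $V(-x)=V(x)$, and single-well, that is, for some $x_0\in I$ it is non-increasing on $(-1,x_0)$ and non-decreasing on $(x_0,1)$. Then $\lambda_0^V$ and $\lambda_1^V$ are eigenvalues of the Robin problem, and $$\Gamma_p(V)\ge\Gamma_p(0),$$ with equality only when $V$ is constant. -/

import Mathlib

open MeasureTheory Set
open scoped ENNReal ContDiff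

noncomputable section

namespace RobinGap

instance factOneLeOfReal (p : ℝ) [h : Fact (1 < p)] : Fact (1 ≤ ENNReal.ofReal p) :=
  ⟨by simpa using ENNReal.ofReal_le_ofReal h.out.le⟩

/-- Lebesgue measure on the open interval `I = (-1, 1)`. -/
abbrev volI : Measure ℝ := volume.restrict (Ioo (-1 : ℝ) 1)

/-- Extension of a function on `[-1, 1]` to the real line, constant outside `[-1, 1]`.
Only its values on `[-1, 1]` are ever used. -/
abbrev ext (u : C(Icc (-1 : ℝ) 1, ℝ)) : ℝ → ℝ :=
  IccExtend (neg_le_self zero_le_one) u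

/-- `g` is the weak (distributional) derivative of `u` on `I`. -/
def IsWeakDeriv (u g : ℝ → ℝ) : Prop :=
  ∀ φ : ℝ → ℝ, ContDiff ℝ ∞ φ → HasCompactSupport φ → tsupport φ ⊆ Ioo (-1 : ℝ) 1 →
    ∫ x, u x * deriv φ x ∂volI = -∫ x, g x * φ x ∂volI

theorem integrable_ext_mul_deriv (u : C(Icc (-1 : ℝ) 1, ℝ)) {φ : ℝ → ℝ}
    (hφ : ContDiff ℝ ∞ φ) : Integrable (fun x => ext u x * deriv φ x) volI := by
  have hc : Continuous (fun x => ext u x * deriv φ x) :=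
    (u.continuous.Icc_extend').mul (hφ.continuous_deriv (by simp))
  exact (hc.continuousOn.integrableOn_compact isCompact_Icc).mono_set Ioo_subset_Icc_self

theorem integrable_lp_mul {q : ℝ≥0∞} [Fact (1 ≤ q)] (g : Lp ℝ q volI) {φ : ℝ → ℝ}
    (hφ : Continuous φ) (hs : HasCompactSupport φ) :
    Integrable (fun x => g x * φ x) volI := by
  have hg : Integrable g volI := (Lp.memLp g).integrable Fact.out
  obtain ⟨C, hC⟩ := hs.exists_bound_of_continuous hφ
  exact hg.mul_bdd (c := C) hφ.aestronglyMeasurable (Filter.Eventually.of_forall hC)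

/-- The Sobolev space `W^{1,p}(I)`. An element is a pair `(u, u')` of the continuous representative
`u` on `[-1, 1]` and its weak derivative `u' ∈ L^p(I)`. The topology is that of the norm
`max (‖u‖_∞) (‖u'‖_p)`, which on the bounded interval `I` is equivalent to the usual norm of
`W^{1,p}(I)`. -/
def W1p (p : ℝ) [Fact (1 < p)] :
    Submodule ℝ (C(Icc (-1 : ℝ) 1, ℝ) × Lp ℝ (ENNReal.ofReal p) volI) where
  carrier := {w | IsWeakDeriv (ext w.1) w.2}
  zero_mem' := by
    intro φ _ _ _
    have h0 : (fun x => (0 : Lp ℝ (ENNReal.ofReal p) volI) x * φ x) =ᵐ[volI] fun _ => 0 := by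
      filter_upwards [Lp.coeFn_zero ℝ (ENNReal.ofReal p) volI] with x hx
      rw [hx, Pi.zero_apply, zero_mul]
    simp only [Prod.fst_zero, Prod.snd_zero]
    rw [integral_congr_ae h0]
    simp [IccExtend]
  add_mem' := by
    intro a b ha hb φ h1 h2 h3
    have e : (fun x => (a + b).2 x * φ x) =ᵐ[volI] fun x => a.2 x * φ x + b.2 x * φ x := by
      filter_upwards [Lp.coeFn_add a.2 b.2] with x hx
      simp only [Prod.snd_add, hx, Pi.add_apply]
      ring
    have e' : (fun x => ext (a + b).1 x * deriv φ x) =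
        fun x => ext a.1 x * deriv φ x + ext b.1 x * deriv φ x := by
      funext x
      simp [IccExtend, add_mul]
    rw [integral_congr_ae e, e',
      integral_add (integrable_ext_mul_deriv _ h1) (integrable_ext_mul_deriv _ h1),
      integral_add (integrable_lp_mul _ h1.continuous h2) (integrable_lp_mul _ h1.continuous h2),
      ha φ h1 h2 h3, hb φ h1 h2 h3]
    ring
  smul_mem' := by
    intro c a ha φ h1 h2 h3
    have e : (fun x => (c • a).2 x * φ x) =ᵐ[volI] fun x => c * (a.2 x * φ x) := by
      filter_upwards [Lp.coeFn_smul c a.2] with x hx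
      simp only [Prod.smul_snd, hx, Pi.smul_apply, smul_eq_mul]
      ring
    have e' : (fun x => ext (c • a).1 x * deriv φ x) =
        fun x => c * (ext a.1 x * deriv φ x) := by
      funext x
      simp [IccExtend, mul_assoc]
    rw [integral_congr_ae e, e', integral_const_mul, integral_const_mul, ha φ h1 h2 h3]
    ring

/-- The (continuous representative of the) Sobolev function `w`, as a function on the line. -/
def fn {p : ℝ} [Fact (1 < p)] (w : W1p p) : ℝ → ℝ := ext w.1.1

/-- The weak derivative of the Sobolev function `w`. -/
def der {p : ℝ} [Fact (1 < p)] (w : W1p p) : ℝ → ℝ := w.1.2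

/-- `u` is a weak solution of `-Δ_p u + V |u|^{p-2} u = lam |u|^{p-2} u` on `I` with the Robin
boundary conditions `|u'|^{p-2} u' = ∓ α |u|^{p-2} u` at `±1`. -/
def IsSolution (p : ℝ) [Fact (1 < p)] (α : ℝ) (V : ℝ → ℝ) (lam : ℝ) (u : W1p p) : Prop :=
  ∀ ξ : ℝ → ℝ, ContDiff ℝ 1 ξ →
    (∫ x, |der u x| ^ (p - 2) * der u x * deriv ξ x
        + (V x - lam) * (|fn u x| ^ (p - 2) * fn u x) * ξ x ∂volI)
      + α * (|fn u 1| ^ (p - 2) * fn u 1 * ξ 1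
        + |fn u (-1)| ^ (p - 2) * fn u (-1) * ξ (-1)) = 0

/-- `lam` is an eigenvalue: the Robin problem has a nonzero weak solution. -/
def IsEigenvalue (p : ℝ) [Fact (1 < p)] (α : ℝ) (V : ℝ → ℝ) (lam : ℝ) : Prop :=
  ∃ u : W1p p, u ≠ 0 ∧ IsSolution p α V lam u

/-- The Rayleigh quotient. -/
def rayleigh (p : ℝ) [Fact (1 < p)] (α : ℝ) (V : ℝ → ℝ) (u : W1p p) : ℝ :=
  ((∫ x, |der u x| ^ p + V x * |fn u x| ^ p ∂volI) + α * (|fn u 1| ^ p + |fn u (-1)| ^ p)) /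
    ∫ x, |fn u x| ^ p ∂volI

/-- There is a continuous odd map from `A` to `ℝⁿ ∖ {0}`. -/
def HasOddMap {E : Type*} [TopologicalSpace E] [Neg E] (A : Set E) (n : ℕ) : Prop :=
  ∃ h : E → Fin n → ℝ, ContinuousOn h A ∧ (∀ x ∈ A, h (-x) = -h x) ∧ ∀ x ∈ A, h x ≠ 0

/-- The Krasnoselskii genus of a symmetric set: the least `n` such that there is a continuous odd
map from `A` to `ℝⁿ ∖ {0}`, and `⊤` if there is none. -/
def genus {E : Type*} [TopologicalSpace E] [Neg E] (A : Set E) : ℕ∞ :=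
  ⨅ (n : ℕ) (_ : HasOddMap A n), (n : ℕ∞)

/-- The admissible sets of the `i`-th minimax problem (`i = 0, 1, 2, …`): the compact symmetric
subsets of `W^{1,p}(I) ∖ {0}` of genus at least `i + 1`. -/
def admissible (p : ℝ) [Fact (1 < p)] (i : ℕ) : Set (Set (W1p p)) :=
  {A | IsCompact A ∧ (∀ u ∈ A, -u ∈ A) ∧ (0 : W1p p) ∉ A ∧ ((i + 1 : ℕ) : ℕ∞) ≤ genus A}

/-- The `i`-th Ljusternik–Schnirelmann eigenvalue `inf_A max_{u ∈ A} R[u]`, the infimum over all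
admissible `A`. -/
def eigenvalue (p : ℝ) [Fact (1 < p)] (α : ℝ) (V : ℝ → ℝ) (i : ℕ) : ℝ :=
  sInf {c | ∃ A ∈ admissible p i, IsGreatest (rayleigh p α V '' A) c}

/-- The fundamental gap `Γ_p(V) = λ₁ - λ₀`. -/
def gap (p : ℝ) [Fact (1 < p)] (α : ℝ) (V : ℝ → ℝ) : ℝ :=
  eigenvalue p α V 1 - eigenvalue p α V 0

/-- `V` is single-well on `I`. -/
def IsSingleWell (V : ℝ → ℝ) : Prop :=
  ∃ x₀ ∈ Ioo (-1 : ℝ) 1, AntitoneOn V (Ioo (-1) x₀) ∧ MonotoneOn V (Ioo x₀ 1)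

/-- `V` is symmetric on `[-1, 1]`. -/
def IsSymmetric (V : ℝ → ℝ) : Prop :=
  ∀ x ∈ Icc (-1 : ℝ) 1, V (-x) = V x

end RobinGap

end

noncomputable section

namespace RobinGap

open Filter Topology NNReal

/-! ### Comparison for scalar differential inequalities -/

/-! Since V is even, everything happens on `[0, 1]`: λ₀ is the first eigenvalue with a Neumann
condition at 0, λ₁ the first one with a Dirichlet condition at 0, both with the Robin condition at
1. A symmetric single-well potential is non-decreasing on `[0, 1]`.

For a positive solution u on the half interval, `w = |u'|^{p-2} u' / u^{p-1}` solves the first-order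
equation `w' = V - lam - (p - 1)|w|^q`, with q conjugate to p. The Robin condition becomes `w 1 =
-α`; the condition at 0 becomes `w 0 = 0` (Neumann) or `w → +∞` (Dirichlet). The number lam is found
by shooting (`riccati_shooting`), the Dirichlet case being the monotone limit of the problems `w 0 =
n` (`exists_dirichletRiccati`). Picone's inequality (`Riccati.picone`) shows that lam bounds the
Rayleigh quotient from below on the half interval, so no compactness argument for minimizers is
needed. Comparison from the right endpoint (`Riccati.le_of_right`) orders Riccati solutions.

The gap is compared in small steps (`gap_step`). Let a non-decreasing Q be added to V, let u be the
Neumann eigenfunction before and v the Dirichlet eigenfunction after the addition. Using each as a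
test function in the other problem, λ₀ grows by at most the `u^p`-average of Q and λ₁ by at least
its `v^p`-average. If the oscillation of Q does not exceed the current gap, Riccati comparison makes
v/u non-decreasing, and Chebyshev's inequality (`chebyshev_weighted`) orders the two averages, with
equality only if Q takes equal values at 0 and 1. Moving from 0 to V through the potentials `(k/N)
V` with N large (`exists_gap_le`) gives the theorem: the gap never drops below its initial value, so
the same step size stays admissible.

The minimax values are identified by `eigenvalue_zero_of_neumannRiccati` and
`eigenvalue_one_of_dirichletRiccati`. For λ₁, evaluation at 0 is an odd continuous map, so every
admissible set contains a function vanishing at 0; conversely, the two half-eigenfunctions span a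
loop of genus at least two on which the Rayleigh quotient is constant. -/

theorem nonpos_of_deriv_le_mul {D D' : ℝ → ℝ} {a b L : ℝ} (hc : ContinuousOn D (Icc a b))
    (hd : ∀ x ∈ Ioo a b, HasDerivAt D (D' x) x)
    (h : ∀ x ∈ Ioo a b, 0 < D x → D' x ≤ L * D x) (ha : D a ≤ 0) :
    ∀ x ∈ Icc a b, D x ≤ 0 := by
  intro z hz
  by_contra! hpos
  set S := {t | t ∈ Icc a z ∧ D t ≤ 0} with hS
  have hSc : IsClosed S := by
    have h1 : ContinuousOn D (Icc a z) := hc.mono (Icc_subset_Icc_right hz.2)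
    exact h1.preimage_isClosed_of_isClosed isClosed_Icc isClosed_Iic
  have hSn : S.Nonempty := ⟨a, ⟨le_rfl, hz.1⟩, ha⟩
  have hSb : BddAbove S := ⟨z, fun t ht => ht.1.2⟩
  -- After the last time s before z at which D is non-positive, D stays positive, so `D t * exp (-L
  -- t)` is non-increasing there and cannot become positive.
  obtain ⟨⟨hs1, hs2⟩, hs3⟩ := hSc.csSup_mem hSn hSb
  set s := sSup S
  have hsz : s < z := lt_of_le_of_ne hs2 (by rintro h; rw [h] at hs3; linarith)
  have hpos' : ∀ t ∈ Ioo s z, 0 < D t := by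
    intro t ht
    by_contra! hle
    exact absurd (le_csSup hSb ⟨⟨hs1.trans ht.1.le, ht.2.le⟩, hle⟩) (not_le.2 ht.1)
  have hsub : ∀ t ∈ Ioo s z, t ∈ Ioo a b := fun t ht => ⟨hs1.trans_lt ht.1, ht.2.trans_le hz.2⟩
  have hder : ∀ t ∈ Ioo s z, HasDerivAt (fun t => D t * Real.exp (-L * t))
      ((D' t - L * D t) * Real.exp (-L * t)) t := by
    intro t ht
    have h1 : HasDerivAt (fun t => Real.exp (-L * t)) (Real.exp (-L * t) * (-L * 1)) t :=
      ((hasDerivAt_id t).const_mul (-L)).exp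
    convert! (hd t (hsub t ht)).mul h1 using 1
    ring
  have hanti : AntitoneOn (fun t => D t * Real.exp (-L * t)) (Icc s z) := by
    apply antitoneOn_of_deriv_nonpos (convex_Icc _ _)
    · exact (hc.mono (Icc_subset_Icc hs1 hz.2)).mul (by fun_prop)
    · rw [interior_Icc]
      exact fun t ht => (hder t ht).differentiableAt.differentiableWithinAt
    · rw [interior_Icc]
      intro t ht
      rw [(hder t ht).deriv]
      exact mul_nonpos_of_nonpos_of_nonneg (by linarith [h t (hsub t ht) (hpos' t ht)])
        (Real.exp_pos _).le
  have := hanti (left_mem_Icc.2 hsz.le) (right_mem_Icc.2 hsz.le) hsz.le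
  simp only at this
  have h1 : 0 < D z * Real.exp (-L * z) := by positivity
  have h2 : D s * Real.exp (-L * s) ≤ 0 :=
    mul_nonpos_of_nonpos_of_nonneg hs3 (Real.exp_pos _).le
  linarith

theorem nonpos_of_neg_mul_le_deriv {D D' : ℝ → ℝ} {a b L : ℝ} (hc : ContinuousOn D (Icc a b))
    (hd : ∀ x ∈ Ioo a b, HasDerivAt D (D' x) x)
    (h : ∀ x ∈ Ioo a b, 0 < D x → -(L * D x) ≤ D' x) (hb : D b ≤ 0) :
    ∀ x ∈ Icc a b, D x ≤ 0 := by
  have key := nonpos_of_deriv_le_mul (D := fun x => D (-x)) (D' := fun x => -D' (-x)) (a := -b)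
    (b := -a) (L := L) ?_ ?_ ?_ (by simpa using hb)
  · intro x hx
    simpa using key (-x) ⟨neg_le_neg hx.2, neg_le_neg hx.1⟩
  · exact hc.comp continuousOn_neg fun x hx => ⟨by linarith [hx.2], by linarith [hx.1]⟩
  · intro x hx
    have := hd (-x) ⟨by linarith [hx.2], by linarith [hx.1]⟩
    convert! this.comp x (hasDerivAt_neg x) using 1
    ring
  · intro x hx hp
    have := h (-x) ⟨by linarith [hx.2], by linarith [hx.1]⟩ hp
    linarith

/-! ### The Riccati equation -/

theorem exists_abs_rpow_lipschitz {q : ℝ} (hq : 1 < q) (H : ℝ) :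
    ∃ K : ℝ≥0, ∀ x y : ℝ, |x| ≤ H → |y| ≤ H → |(|x| ^ q - |y| ^ q)| ≤ K * |x - y| := by
  have hc : ContDiff ℝ 1 (fun x : ℝ => ‖x‖ ^ q) := contDiff_norm_rpow hq
  obtain ⟨K, hK⟩ := hc.contDiffOn.exists_lipschitzOnWith (by decide) (convex_Icc (-H) H)
    isCompact_Icc
  refine ⟨K, fun x y hx hy => ?_⟩
  have := hK.dist_le_mul x (abs_le.1 hx) y (abs_le.1 hy)
  simpa [Real.dist_eq] using this

/-- The function `w` solves the Riccati equation `w' = c - (p - 1) |w|^q` on `(a, b)`. -/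
def Riccati (p q : ℝ) (c w : ℝ → ℝ) (a b : ℝ) : Prop :=
  ∀ x ∈ Ioo a b, HasDerivAt w (c x - (p - 1) * |w x| ^ q) x

theorem exists_abs_le_of_continuousOn {w : ℝ → ℝ} {a b : ℝ} (h : ContinuousOn w (Icc a b)) :
    ∃ H, ∀ x ∈ Icc a b, |w x| ≤ H :=
  isCompact_Icc.exists_bound_of_continuousOn h

/-- The difference `w₂ - w₁` satisfies `D' ≥ -L D` wherever it is positive, because `|·|^q` is
Lipschitz on the bounded range of the two solutions. Comparison starts at the right endpoint since
that is where the Robin condition fixes the value. -/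
theorem Riccati.le_of_right {p q : ℝ} (hp : 1 < p) (hq : 1 < q) {c₁ c₂ w₁ w₂ : ℝ → ℝ} {a b : ℝ}
    (h₁ : Riccati p q c₁ w₁ a b) (h₂ : Riccati p q c₂ w₂ a b)
    (hc₁ : ContinuousOn w₁ (Icc a b)) (hc₂ : ContinuousOn w₂ (Icc a b))
    (hc : ∀ x ∈ Ioo a b, c₁ x ≤ c₂ x) (hb : w₂ b ≤ w₁ b) : ∀ x ∈ Icc a b, w₂ x ≤ w₁ x := by
  obtain ⟨H₁, hH₁⟩ := exists_abs_le_of_continuousOn hc₁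
  obtain ⟨H₂, hH₂⟩ := exists_abs_le_of_continuousOn hc₂
  obtain ⟨K, hK⟩ := exists_abs_rpow_lipschitz hq (max H₁ H₂)
  have key := nonpos_of_neg_mul_le_deriv (L := (p - 1) * K) (hc₂.sub hc₁)
    (fun x hx => (h₂ x hx).sub (h₁ x hx)) ?_ (by simpa using hb)
  · intro x hx
    simpa using key x hx
  · intro x hx hpos
    have hx' := Ioo_subset_Icc_self hx
    have := hK (w₂ x) (w₁ x) ((hH₂ x hx').trans (le_max_right _ _))
      ((hH₁ x hx').trans (le_max_left _ _))
    simp only [Pi.sub_apply] at hpos ⊢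
    rw [abs_of_pos hpos] at this
    have h3 := mul_le_mul_of_nonneg_left ((le_abs_self _).trans this) (sub_pos.2 hp).le
    linarith [hc x hx]

/-! ### Shooting -/

theorem exists_bounded_solution {V G : ℝ → ℝ} (hV : Continuous V) {K : ℝ≥0}
    (hG : LipschitzWith K G) {M : ℝ} (hM : ∀ x, |G x| ≤ M) (a lam : ℝ) :
    ∃ w : ℝ → ℝ, w 0 = a ∧
      ∀ t ∈ Icc (0 : ℝ) 1, HasDerivWithinAt w (V t - lam - G (w t)) (Icc 0 1) t := by
  obtain ⟨B, hB⟩ := exists_abs_le_of_continuousOn (a := 0) (b := 1) hV.continuousOn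
  have hB0 : 0 ≤ B := (abs_nonneg _).trans (hB 0 (by simp))
  have hM0 : 0 ≤ M := (abs_nonneg _).trans (hM 0)
  -- L bounds the vector field. As the time interval has length 1 and the field is globally
  -- Lipschitz in x, L also serves as the radius and the solution exists on all of `[0, 1]`.
  let L : ℝ≥0 := ⟨B + |lam| + M, by positivity⟩
  have hPL : IsPicardLindelof (fun t x => V t - lam - G x)
      (⟨0, by simp⟩ : Icc (0 : ℝ) 1) a L 0 L K := by
    refine ⟨fun t _ => ?_, fun x _ => ?_, fun t ht x _ => ?_, ?_⟩
    · apply LipschitzWith.lipschitzOnWith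
      refine LipschitzWith.of_dist_le_mul fun x y => ?_
      rw [Real.dist_eq, show V t - lam - G x - (V t - lam - G y) = -(G x - G y) by ring, abs_neg]
      exact hG.dist_le_mul x y
    · fun_prop
    · have h1 := hB t ht
      have h2 := hM x
      simp only [Real.norm_eq_abs]
      change _ ≤ B + |lam| + M
      calc |V t - lam - G x| ≤ |V t - lam| + |G x| := abs_sub _ _
        _ ≤ |V t| + |lam| + |G x| := by gcongr; exact abs_sub _ _
        _ ≤ _ := by gcongr
    · simp
  exact hPL.exists_eq_forall_mem_Icc_hasDerivWithinAt₀

/-- The endpoint value depends continuously on lam by Grönwall, and the mean value theorem pushes it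
above or below b for suitable lam; the intermediate value theorem then applies. -/
theorem shooting_bounded {V G : ℝ → ℝ} (hV : Continuous V) {K : ℝ≥0}
    (hG : LipschitzWith K G) {M : ℝ} (hM : ∀ x, |G x| ≤ M) (a b : ℝ) :
    ∃ (lam : ℝ) (w : ℝ → ℝ), w 0 = a ∧ w 1 = b ∧ ContinuousOn w (Icc 0 1) ∧
      ∀ t ∈ Ioo (0 : ℝ) 1, HasDerivAt w (V t - lam - G (w t)) t := by
  choose w hw0 hw using exists_bounded_solution hV hG hM a
  have hcont : ∀ lam, ContinuousOn (w lam) (Icc 0 1) := fun lam t ht =>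
    (hw lam t ht).continuousWithinAt
  have hint : ∀ lam, ∀ t ∈ Ioo (0 : ℝ) 1, HasDerivAt (w lam) (V t - lam - G (w lam t)) t :=
    fun lam t ht => (hw lam t (Ioo_subset_Icc_self ht)).hasDerivAt (Icc_mem_nhds ht.1 ht.2)
  have hright : ∀ lam, ∀ t ∈ Ico (0 : ℝ) 1,
      HasDerivWithinAt (w lam) (V t - lam - G (w lam t)) (Ici t) t := fun lam t ht =>
    (hw lam t (Ico_subset_Icc_self ht)).mono_of_mem_nhdsWithin
      (mem_of_superset (Icc_mem_nhdsGE ht.2) (Icc_subset_Icc_left ht.1))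
  have hdist : ∀ lam mu, dist (w mu 1) (w lam 1) ≤ gronwallBound 0 K (|mu - lam| + 0) (1 - 0) := by
    intro lam mu
    refine dist_le_of_approx_trajectories_ODE (v := fun t x => V t - lam - G x)
      (f' := fun t => V t - mu - G (w mu t)) (g' := fun t => V t - lam - G (w lam t))
      ?_ (hcont mu) (hright mu) ?_ (hcont lam) (hright lam) ?_ ?_ 1 (by simp)
    · intro t
      refine LipschitzWith.of_dist_le_mul fun x y => ?_
      rw [Real.dist_eq, show V t - lam - G x - (V t - lam - G y) = -(G x - G y) by ring, abs_neg]
      exact hG.dist_le_mul x y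
    · intro t _
      rw [Real.dist_eq]
      apply le_of_eq
      rw [abs_sub_comm mu]
      congr 1
      ring
    · intro t _
      simp
    · simp [hw0]
  have hc1 : Continuous fun lam => w lam 1 := by
    rw [continuous_iff_continuousAt]
    intro lam
    rw [ContinuousAt, tendsto_iff_dist_tendsto_zero]
    refine squeeze_zero (fun _ => dist_nonneg) (hdist lam) ?_
    have h1 : Continuous fun mu : ℝ => gronwallBound 0 K (|mu - lam| + 0) (1 - 0) :=
      (gronwallBound_continuous_ε 0 K (1 - 0)).comp (by fun_prop)
    have h2 := h1.tendsto lam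
    simpa [gronwallBound_ε0_δ0] using h2
  obtain ⟨B, hB⟩ := exists_abs_le_of_continuousOn (a := 0) (b := 1) hV.continuousOn
  have hmv : ∀ lam, ∃ t ∈ Ioo (0 : ℝ) 1, V t - lam - G (w lam t) = w lam 1 - a := by
    intro lam
    obtain ⟨t, ht, h⟩ := exists_hasDerivAt_eq_slope (w lam) _ one_pos (hcont lam) (hint lam)
    exact ⟨t, ht, by rw [h, hw0]; ring⟩
  have hlow : ∃ lam, b ≤ w lam 1 := by
    refine ⟨a - b - B - M, ?_⟩
    obtain ⟨t, ht, h⟩ := hmv (a - b - B - M)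
    have h1 := abs_le.1 (hB t (Ioo_subset_Icc_self ht))
    have h2 := abs_le.1 (hM (w (a - b - B - M) t))
    linarith
  have hhigh : ∃ lam, w lam 1 ≤ b := by
    refine ⟨a - b + B + M, ?_⟩
    obtain ⟨t, ht, h⟩ := hmv (a - b + B + M)
    have h1 := abs_le.1 (hB t (Ioo_subset_Icc_self ht))
    have h2 := abs_le.1 (hM (w (a - b + B + M) t))
    linarith
  obtain ⟨l₁, h₁⟩ := hlow
  obtain ⟨l₂, h₂⟩ := hhigh
  obtain ⟨lam, hlam⟩ := mem_range_of_exists_le_of_exists_ge hc1 ⟨l₂, h₂⟩ ⟨l₁, h₁⟩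
  exact ⟨lam, w lam, hw0 lam, hlam, hcont lam, hint lam⟩

/-- The nonlinearity is truncated at height H so that `shooting_bounded` applies; a priori bounds
then show that the solution never reaches the truncated region. -/
theorem riccati_shooting {p q : ℝ} (hp : 1 < p) (hq : 1 < q) {V : ℝ → ℝ} (hV : Continuous V)
    (a b : ℝ) : ∃ (lam : ℝ) (w : ℝ → ℝ), w 0 = a ∧ w 1 = b ∧ ContinuousOn w (Icc 0 1) ∧
      Riccati p q (fun x => V x - lam) w 0 1 := by
  obtain ⟨B, hB⟩ := exists_abs_le_of_continuousOn (a := 0) (b := 1) hV.continuousOn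
  have hB0 : 0 ≤ B := (abs_nonneg _).trans (hB 0 (by simp))
  have hp0 : 0 ≤ p - 1 := by linarith
  -- m bounds the segment from a to b + 1 used as a subsolution, Λ bounds lam, and H bounds w. The
  -- definition of Λ involves m but not H, so the choice is not circular.
  set m : ℝ := |a| + |b| + 1 with hm
  set Λ : ℝ := B + (p - 1) * m ^ q + |b - a + 1| + |a - b| with hΛ
  have hm0 : 0 ≤ m := by positivity
  set C : ℝ := B + Λ
  have hC0 : 0 ≤ C := by positivity
  set H : ℝ := |a| + |b| + C with hH
  have hH0 : 0 ≤ H := by positivity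
  obtain ⟨K, hK⟩ := exists_abs_rpow_lipschitz hq H
  set G : ℝ → ℝ := fun x => (p - 1) * (min |x| H) ^ q with hG
  have hmin0 : ∀ x : ℝ, 0 ≤ min |x| H := fun x => le_min (abs_nonneg _) hH0
  have hGL : ∀ x y, |G x - G y| ≤ (p - 1) * K * |x - y| := by
    intro x y
    have h1 := hK (min |x| H) (min |y| H) (by rw [abs_of_nonneg (hmin0 x)]; exact min_le_right _ _)
      (by rw [abs_of_nonneg (hmin0 y)]; exact min_le_right _ _)
    rw [abs_of_nonneg (hmin0 x), abs_of_nonneg (hmin0 y)] at h1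
    have h2 : |min |x| H - min |y| H| ≤ |x - y| :=
      (abs_min_sub_min_le_max _ _ _ _).trans (by simpa using abs_abs_sub_abs_le x y)
    calc |G x - G y| = (p - 1) * |min |x| H ^ q - min |y| H ^ q| := by
          rw [hG]; simp only; rw [← mul_sub, abs_mul, abs_of_nonneg hp0]
      _ ≤ (p - 1) * (K * |x - y|) := by gcongr; exact h1.trans (by gcongr)
      _ = _ := by ring
  have hG0 : ∀ x, 0 ≤ G x := fun x => mul_nonneg hp0 (Real.rpow_nonneg (hmin0 x) _)
  have hGM : ∀ x, |G x| ≤ (p - 1) * H ^ q := by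
    intro x
    rw [abs_of_nonneg (hG0 x)]
    simp only [hG]
    gcongr
    exact min_le_right _ _
  have hLip : LipschitzWith ((p - 1).toNNReal * K) G := by
    refine LipschitzWith.of_dist_le_mul fun x y => ?_
    simpa [Real.dist_eq, hp0] using hGL x y
  obtain ⟨lam, w, hw0, hw1, hwc, hw⟩ := shooting_bounded hV hLip hGM a b
  have hlam1 : lam ≤ Λ := by
    obtain ⟨t, ht, h⟩ := exists_hasDerivAt_eq_slope w _ one_pos hwc hw
    have h1 := abs_le.1 (hB t (Ioo_subset_Icc_self ht))
    rw [hw1, hw0] at h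
    have h2 := hG0 (w t)
    have h3 := le_abs_self (a - b)
    have h4 : 0 ≤ (p - 1) * m ^ q + |b - a + 1| := by positivity
    linarith
  -- If lam were below -Λ, the segment from `(0, a)` to `(1, b + 1)` would be a subsolution, forcing
  -- `w 1 ≥ b + 1`.
  have hlam2 : -Λ ≤ lam := by
    by_contra! hlt
    have key := nonpos_of_deriv_le_mul (D := fun x => a + (b - a + 1) * x - w x)
      (D' := fun x => (b - a + 1) - (V x - lam - G (w x))) (a := 0) (b := 1) (L := (p - 1) * K)
      ?_ ?_ ?_ (by simp [hw0]) 1 (by simp)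
    · simp only [hw1] at key
      linarith
    · exact ContinuousOn.sub (by fun_prop) hwc
    · intro x hx
      refine HasDerivAt.sub ?_ (hw x hx)
      simpa using ((hasDerivAt_id x).const_mul (b - a + 1)).const_add a
    · intro x hx hpos
      set z := a + (b - a + 1) * x with hz
      have hzm : |z| ≤ m := by
        have : z = (1 - x) * a + x * (b + 1) := by rw [hz]; ring
        rw [abs_le]
        have ha1 := abs_le.1 (le_refl |a|)
        have hb1 := abs_le.1 (le_refl |b|)
        have hx0 := hx.1.le
        have hx1 := sub_nonneg.2 hx.2.le
        constructor <;> rw [this] <;>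
          nlinarith [mul_le_mul_of_nonneg_left ha1.1 hx1, mul_le_mul_of_nonneg_left ha1.2 hx1,
            mul_le_mul_of_nonneg_left hb1.1 hx0, mul_le_mul_of_nonneg_left hb1.2 hx0,
            mul_nonneg hx1 (abs_nonneg b), mul_nonneg hx0 (abs_nonneg a)]
      have hGz : G z ≤ (p - 1) * m ^ q := by
        simp only [hG]
        gcongr
        exact (min_le_left _ _).trans hzm
      have hL := (abs_le.1 (hGL (w x) z)).2
      rw [abs_sub_comm, abs_of_pos hpos] at hL
      have h1 := abs_le.1 (hB x (Ioo_subset_Icc_self hx))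
      have h2 := le_abs_self (b - a + 1)
      have h3 := abs_nonneg (a - b)
      linarith
  -- As G is non-negative, w has slope at most C. Integrating from 0 bounds w above through a,
  -- integrating up to 1 bounds it below through b.
  have hbound : ∀ x ∈ Icc (0 : ℝ) 1, |w x| ≤ H := by
    intro x hx
    have hup : ∀ s ∈ Icc (0 : ℝ) 1, ∀ t ∈ Icc (0 : ℝ) 1, s ≤ t → w t - w s ≤ C * (t - s) := by
      intro s hs t ht hst
      apply (convex_Icc (0 : ℝ) 1).image_sub_le_mul_sub_of_deriv_le hwc _ _ s hs t ht hst
      · rw [interior_Icc]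
        exact fun y hy => (hw y hy).differentiableAt.differentiableWithinAt
      · rw [interior_Icc]
        intro y hy
        rw [(hw y hy).deriv]
        have h1 := abs_le.1 (hB y (Ioo_subset_Icc_self hy))
        have h2 := hG0 (w y)
        linarith
    have h1 := hup 0 (by simp) x hx hx.1
    have h2 := hup x hx 1 (by simp) hx.2
    rw [hw0] at h1
    rw [hw1] at h2
    have h3 : C * (x - 0) ≤ C := by nlinarith [hx.2]
    have h4 : C * (1 - x) ≤ C := by nlinarith [hx.1]
    rw [abs_le]
    have := le_abs_self a
    have := neg_abs_le b
    have := abs_nonneg a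
    have := abs_nonneg b
    constructor <;> linarith
  refine ⟨lam, w, hw0, hw1, hwc, fun x hx => ?_⟩
  have := hw x hx
  simpa only [hG, min_eq_left (hbound x (Ioo_subset_Icc_self hx))] using this

/-! ### Picone's inequality -/

theorem absolutelyContinuousOnInterval_abs_rpow {f : ℝ → ℝ} {a b p : ℝ} (hp : 1 < p)
    (hf : AbsolutelyContinuousOnInterval f a b) :
    AbsolutelyContinuousOnInterval (fun x => |f x| ^ p) a b := by
  obtain ⟨C, hC⟩ := hf.exists_bound
  obtain ⟨K, hK⟩ := exists_abs_rpow_lipschitz hp C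
  unfold AbsolutelyContinuousOnInterval at hf ⊢
  apply squeeze_zero' ?_ ?_ (by simpa using hf.const_mul (K : ℝ))
  · exact Eventually.of_forall fun _ => Finset.sum_nonneg fun i _ => dist_nonneg
  · rw [eventually_inf_principal]
    filter_upwards with E hE
    rw [Finset.mul_sum]
    refine Finset.sum_le_sum fun i hi => ?_
    exact hK _ _ (hC _ (hE.1 i hi).1) (hC _ (hE.1 i hi).2)

theorem abs_abs_rpow_sub_two_mul {p : ℝ} (hp : 1 < p) (x : ℝ) :
    |(|x| ^ (p - 2) * x)| = |x| ^ (p - 1) := by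
  rcases eq_or_ne x 0 with rfl | h
  · simp [Real.zero_rpow (by linarith : p - 1 ≠ 0)]
  · rw [abs_mul, abs_of_nonneg (Real.rpow_nonneg (abs_nonneg _) _),
      ← Real.rpow_add_one (abs_ne_zero.2 h)]
    ring_nf

/-- This is p times Young's inequality for the factors g and `w |f|^{p-2} f`; conjugacy turns the
q-th power of the second into `|w|^q |f|^p` and p/q into p - 1. -/
theorem young_riccati {p q : ℝ} (hpq : p.HolderConjugate q) (w f g : ℝ) :
    w * (p * |f| ^ (p - 2) * f * g) ≤ |g| ^ p + (p - 1) * |w| ^ q * |f| ^ p := by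
  have hp := hpq.lt
  have h := Real.young_inequality g (w * (|f| ^ (p - 2) * f)) hpq
  have h1 : |w * (|f| ^ (p - 2) * f)| ^ q = |w| ^ q * |f| ^ p := by
    rw [abs_mul, abs_abs_rpow_sub_two_mul hp, Real.mul_rpow (abs_nonneg _) (by positivity),
      ← Real.rpow_mul (abs_nonneg _)]
    congr 2
    exact hpq.sub_one_mul_conj
  rw [h1] at h
  have h2 : p * (|w| ^ q * |f| ^ p / q) = (p - 1) * |w| ^ q * |f| ^ p := by
    have : p / q = p - 1 := hpq.div_conj_eq_sub_one
    rw [← this]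
    ring
  have h3 := mul_le_mul_of_nonneg_left h hpq.pos.le
  have h4 : p * (|g| ^ p / p) = |g| ^ p := by field_simp [hpq.pos.ne']
  calc w * (p * |f| ^ (p - 2) * f * g) = p * (g * (w * (|f| ^ (p - 2) * f))) := by ring
    _ ≤ _ := h3
    _ = _ := by rw [mul_add, h4, h2]

theorem Riccati.eq_integral {p q : ℝ} (hq : 1 < q) {c w : ℝ → ℝ} {a b : ℝ}
    (hc : ContinuousOn c (Icc a b)) (h : Riccati p q c w a b) (hw : ContinuousOn w (Icc a b)) :
    ∀ s ∈ Icc a b, ∀ t ∈ Icc a b, s ≤ t →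
      ∫ x in s..t, (c x - (p - 1) * |w x| ^ q) = w t - w s := by
  intro s hs t ht hst
  apply intervalIntegral.integral_eq_sub_of_hasDerivAt_of_le hst
    (hw.mono (Icc_subset_Icc hs.1 ht.2))
  · exact fun x hx => h x ⟨hs.1.trans_lt hx.1, hx.2.trans_le ht.2⟩
  · apply ContinuousOn.intervalIntegrable
    rw [uIcc_of_le hst]
    refine ContinuousOn.mono ?_ (Icc_subset_Icc hs.1 ht.2)
    exact hc.sub (continuousOn_const.mul (hw.abs.rpow_const fun x _ => Or.inr (by linarith)))

/-- Picone's inequality, in terms of the logarithmic derivative `w` of a positive solution. -/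
theorem Riccati.picone {p q : ℝ} (hpq : p.HolderConjugate q) {c w f g : ℝ → ℝ} {a b : ℝ}
    (hab : a ≤ b) (hc : ContinuousOn c (Icc a b)) (h : Riccati p q c w a b)
    (hw : ContinuousOn w (Icc a b)) (hg : IntervalIntegrable g volume a b)
    (hgp : IntervalIntegrable (fun x => |g x| ^ p) volume a b)
    (hf : ∀ x ∈ Icc a b, f x = f a + ∫ t in a..x, g t) :
    w b * |f b| ^ p - w a * |f a| ^ p ≤ ∫ x in a..b, |g x| ^ p + c x * |f x| ^ p := by
  have hp := hpq.lt
  have hq := hpq.symm.lt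
  set d : ℝ → ℝ := fun x => c x - (p - 1) * |w x| ^ q with hd
  have hdc : ContinuousOn d (Icc a b) :=
    hc.sub (continuousOn_const.mul (hw.abs.rpow_const fun x _ => Or.inr (by linarith)))
  have hdi : IntervalIntegrable d volume a b := by
    apply ContinuousOn.intervalIntegrable
    rwa [uIcc_of_le hab]
  -- F and W are primitives agreeing with f and w on `[a, b]`. The product `W |F|^p` is absolutely
  -- continuous, so it is the integral of its a.e. derivative, which `young_riccati` bounds
  -- pointwise.
  set F : ℝ → ℝ := fun x => f a + ∫ t in a..x, g t
  set W : ℝ → ℝ := fun x => w a + ∫ t in a..x, d t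
  have hconst : ∀ r : ℝ, AbsolutelyContinuousOnInterval (fun _ : ℝ => r) a b := fun r =>
    (LipschitzWith.const r).lipschitzOnWith.absolutelyContinuousOnInterval
  have hFac : AbsolutelyContinuousOnInterval F a b :=
    (hconst _).add (hg.absolutelyContinuousOnInterval_intervalIntegral (by simp))
  have hWac : AbsolutelyContinuousOnInterval W a b :=
    (hconst _).add (hdi.absolutelyContinuousOnInterval_intervalIntegral (by simp))
  have hPac := hWac.fun_mul (absolutelyContinuousOnInterval_abs_rpow hp hFac)
  have hFf : ∀ x ∈ Icc a b, F x = f x := fun x hx => (hf x hx).symm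
  have hWw : ∀ x ∈ Icc a b, W x = w x := fun x hx => by
    simp only [W]
    rw [h.eq_integral hq hc hw a (left_mem_Icc.2 hab) x hx hx.1]
    ring
  have hfc : ContinuousOn f (Icc a b) := by
    refine ContinuousOn.congr ?_ hf
    have := hFac.continuousOn
    rwa [uIcc_of_le hab] at this
  have hfpc : ContinuousOn (fun x => |f x| ^ p) (Icc a b) :=
    hfc.abs.rpow_const fun x _ => Or.inr (by linarith)
  have hint := hPac.integral_deriv_eq_sub
  rw [hWw b (right_mem_Icc.2 hab), hWw a (left_mem_Icc.2 hab), hFf b (right_mem_Icc.2 hab),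
    hFf a (left_mem_Icc.2 hab)] at hint
  rw [← hint]
  refine intervalIntegral.integral_mono_ae_restrict hab hPac.intervalIntegrable_deriv ?_ ?_
  · refine hgp.add (ContinuousOn.intervalIntegrable ?_)
    rw [uIcc_of_le hab]
    exact hc.mul hfpc
  · rw [EventuallyLE, ae_restrict_iff' measurableSet_Icc]
    filter_upwards [hg.ae_hasDerivAt_integral, hdi.ae_hasDerivAt_integral] with x hx1 hx2 hx
    have hx' : x ∈ uIcc a b := by rwa [uIcc_of_le hab]
    have hF' : HasDerivAt F (g x) x := (hx1 hx' a (by simp)).const_add _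
    have hW' : HasDerivAt W (d x) x := (hx2 hx' a (by simp)).const_add _
    have hP' := hW'.mul ((hasDerivAt_abs_rpow (F x) hp).comp x hF')
    have heq : deriv (fun x => W x * |F x| ^ p) x = d x * |f x| ^ p +
        w x * (p * |f x| ^ (p - 2) * f x * g x) := by
      rw [← hFf x hx, ← hWw x hx]
      exact hP'.deriv
    rw [heq]
    have := young_riccati hpq (w x) (f x) (g x)
    simp only [hd]
    linarith

/-! ### Sobolev functions on `[0, 1]` and the two Riccati problems -/

/-- `f` is a Sobolev function on `[0, 1]` with weak derivative `g`. -/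
structure HalfSobolev (p : ℝ) (f g : ℝ → ℝ) : Prop where
  integrable : IntervalIntegrable g volume 0 1
  integrable_rpow : IntervalIntegrable (fun x => |g x| ^ p) volume 0 1
  eq_integral : ∀ x ∈ Icc (0 : ℝ) 1, f x = f 0 + ∫ t in (0 : ℝ)..x, g t

/-- The numerator of the Rayleigh quotient on the interval `[0, 1]`, with a Robin condition
at `1` only. -/
def halfEnergy (p α : ℝ) (V f g : ℝ → ℝ) : ℝ :=
  (∫ x in (0 : ℝ)..1, |g x| ^ p + V x * |f x| ^ p) + α * |f 1| ^ p

/-- The denominator of the Rayleigh quotient on the interval `[0, 1]`. -/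
def halfMass (p : ℝ) (f : ℝ → ℝ) : ℝ := ∫ x in (0 : ℝ)..1, |f x| ^ p

theorem HalfSobolev.continuousOn {p : ℝ} {f g : ℝ → ℝ} (h : HalfSobolev p f g) :
    ContinuousOn f (Icc 0 1) := by
  refine ContinuousOn.congr ?_ h.eq_integral
  have := (h.integrable.absolutelyContinuousOnInterval_intervalIntegral (c := 0)
    (by simp)).continuousOn
  rw [uIcc_of_le zero_le_one] at this
  exact continuousOn_const.add this

theorem HalfSobolev.continuousOn_rpow {p : ℝ} (hp : 1 < p) {f g : ℝ → ℝ} (h : HalfSobolev p f g) :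
    ContinuousOn (fun x => |f x| ^ p) (Icc 0 1) :=
  h.continuousOn.abs.rpow_const fun _ _ => Or.inr (by linarith)

theorem HalfSobolev.intervalIntegrable_rpow {p : ℝ} (hp : 1 < p) {f g : ℝ → ℝ}
    (h : HalfSobolev p f g) : IntervalIntegrable (fun x => |f x| ^ p) volume 0 1 := by
  apply ContinuousOn.intervalIntegrable
  rw [uIcc_of_le zero_le_one]
  exact h.continuousOn_rpow hp

theorem HalfSobolev.intervalIntegrable_mul_rpow {p : ℝ} (hp : 1 < p) {f g V : ℝ → ℝ}
    (hV : Continuous V) (h : HalfSobolev p f g) :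
    IntervalIntegrable (fun x => V x * |f x| ^ p) volume 0 1 := by
  apply ContinuousOn.intervalIntegrable
  rw [uIcc_of_le zero_le_one]
  exact hV.continuousOn.mul (h.continuousOn_rpow hp)

theorem HalfSobolev.halfEnergy_add {p α : ℝ} (hp : 1 < p) {f g V Q : ℝ → ℝ}
    (hV : Continuous V) (hQ : Continuous Q) (h : HalfSobolev p f g) :
    halfEnergy p α (fun x => V x + Q x) f g =
      halfEnergy p α V f g + ∫ x in (0 : ℝ)..1, Q x * |f x| ^ p := by
  have h1 : (fun x => |g x| ^ p + (V x + Q x) * |f x| ^ p) =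
      fun x => (|g x| ^ p + V x * |f x| ^ p) + Q x * |f x| ^ p := by
    funext x
    ring
  rw [halfEnergy, halfEnergy, h1, intervalIntegral.integral_add
    (h.integrable_rpow.add (h.intervalIntegrable_mul_rpow hp hV))
    (h.intervalIntegrable_mul_rpow hp hQ)]
  ring

theorem HalfSobolev.halfEnergy_sub_const {p α : ℝ} (hp : 1 < p) {f g V : ℝ → ℝ}
    (hV : Continuous V) (h : HalfSobolev p f g) (lam : ℝ) :
    halfEnergy p α (fun x => V x - lam) f g = halfEnergy p α V f g - lam * halfMass p f := by
  have := h.halfEnergy_add (α := α) hp hV (continuous_const (y := -lam))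
  simp only [← sub_eq_add_neg, intervalIntegral.integral_const_mul] at this
  rw [this, halfMass]
  ring

/-- Lower bound for the energy coming from a Riccati solution. -/
theorem Riccati.mul_halfMass_le {p q α lam : ℝ} (hpq : p.HolderConjugate q) {V w f g : ℝ → ℝ}
    (hV : Continuous V) (hw : Riccati p q (fun x => V x - lam) w 0 1)
    (hwc : ContinuousOn w (Icc 0 1)) (hw1 : w 1 = -α) (h : HalfSobolev p f g)
    (h0 : w 0 * |f 0| ^ p = 0) : lam * halfMass p f ≤ halfEnergy p α V f g := by
  have h1 := hw.picone hpq zero_le_one (by fun_prop) hwc h.integrable h.integrable_rpow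
    h.eq_integral
  have h2 := h.halfEnergy_sub_const (α := α) hpq.lt hV lam
  rw [halfEnergy] at h2
  rw [hw1, h0] at h1
  linarith

/-- The Riccati problem for the first eigenvalue with a Neumann condition at `0` and a Robin
condition at `1`. -/
structure NeumannRiccati (p q α : ℝ) (V : ℝ → ℝ) (lam : ℝ) (w : ℝ → ℝ) : Prop where
  riccati : Riccati p q (fun x => V x - lam) w 0 1
  continuousOn : ContinuousOn w (Icc 0 1)
  apply_zero : w 0 = 0
  apply_one : w 1 = -α

/-- The Riccati problem for the first eigenvalue with a Dirichlet condition at `0` and a Robin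
condition at `1`. -/
structure DirichletRiccati (p q α : ℝ) (V : ℝ → ℝ) (lam : ℝ) (w : ℝ → ℝ) : Prop where
  riccati : Riccati p q (fun x => V x - lam) w 0 1
  continuousOn : ContinuousOn w (Ioc 0 1)
  tendsto : Tendsto w (𝓝[>] 0) atTop
  apply_one : w 1 = -α
  mul_halfMass_le : ∀ f g, HalfSobolev p f g → f 0 = 0 →
    lam * halfMass p f ≤ halfEnergy p α V f g

theorem exists_neumannRiccati {p q : ℝ} (hpq : p.HolderConjugate q) (α : ℝ) {V : ℝ → ℝ}
    (hV : Continuous V) : ∃ lam w, NeumannRiccati p q α V lam w := by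
  obtain ⟨lam, w, h0, h1, hc, h⟩ := riccati_shooting hpq.lt hpq.symm.lt hV 0 (-α)
  exact ⟨lam, w, h, hc, h0, h1⟩

theorem NeumannRiccati.mul_halfMass_le {p q α lam : ℝ} (hpq : p.HolderConjugate q) {V w : ℝ → ℝ}
    (hV : Continuous V) (h : NeumannRiccati p q α V lam w) {f g : ℝ → ℝ}
    (hf : HalfSobolev p f g) : lam * halfMass p f ≤ halfEnergy p α V f g :=
  h.riccati.mul_halfMass_le hpq hV h.continuousOn h.apply_one hf (by simp [h.apply_zero])

/-- The upper bound for Riccati solutions in the interior, uniform in the value at `0`. -/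
theorem Riccati.mul_rpow_le {p q lam x : ℝ} (hpq : p.HolderConjugate q) {V w : ℝ → ℝ}
    (hV : Continuous V) (hw : Riccati p q (fun x => V x - lam) w 0 1)
    (hwc : ContinuousOn w (Icc 0 1)) (hx : x ∈ Icc (0 : ℝ) 1) :
    w x * |x| ^ p ≤ ∫ t in (0 : ℝ)..x, (1 + (V t - lam) * |t| ^ p) := by
  have h1 := Riccati.picone (f := fun x => x) (g := fun _ => 1) hpq hx.1
    (c := fun x => V x - lam) (by fun_prop)
    (fun y hy => hw y ⟨hy.1, hy.2.trans_le hx.2⟩) (hwc.mono (Icc_subset_Icc_right hx.2))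
    (by simp) (by simp) (by simp)
  simpa [Real.zero_rpow hpq.ne_zero] using h1

theorem integral_abs_rpow_pos {p : ℝ} (hp : 1 < p) : 0 < ∫ t in (0 : ℝ)..1, |t| ^ p := by
  apply intervalIntegral.intervalIntegral_pos_of_pos_on
  · apply Continuous.intervalIntegrable
    exact continuous_abs.rpow_const fun _ => Or.inr (by linarith)
  · intro x hx
    have := hx.1
    positivity
  · exact one_pos

/-- The infinite initial value is approximated by `w 0 = n`. Comparison makes both lam and w
increase with n, and Picone's inequality with the test function x, which vanishes at 0, bounds them
independently of n away from 0. -/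
theorem exists_dirichletRiccati {p q : ℝ} (hpq : p.HolderConjugate q) (α : ℝ) {V : ℝ → ℝ}
    (hV : Continuous V) : ∃ lam w, DirichletRiccati p q α V lam w := by
  have hp := hpq.lt
  have hq := hpq.symm.lt
  choose l w h0 h1 hc h using fun n : ℕ => riccati_shooting hp hq hV (n : ℝ) (-α)
  have hlmono : Monotone l := by
    intro m n hmn
    by_contra! hlt
    have e := Riccati.le_of_right hp hq (h m) (h n) (hc m) (hc n)
      (fun x _ => by linarith) (by rw [h1, h1]) 0 (by simp)
    rw [h0, h0] at e
    have : m = n := le_antisymm hmn (by exact_mod_cast e)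
    exact absurd hlt (by simp [this])
  have hwmono : ∀ x ∈ Icc (0 : ℝ) 1, Monotone fun n => w n x := fun x hx m n hmn =>
    Riccati.le_of_right hp hq (h n) (h m) (hc n) (hc m)
      (fun x _ => by linarith [hlmono hmn]) (by rw [h1, h1]) x hx
  have hcp : Continuous fun t : ℝ => |t| ^ p :=
    continuous_abs.rpow_const fun _ => Or.inr (by linarith)
  have hci : ∀ μ : ℝ, Continuous fun t => 1 + (V t - μ) * |t| ^ p := fun μ =>
    continuous_const.add ((hV.sub continuous_const).mul hcp)
  -- Replacing `l n` by the smaller `l 0` makes the bound of `Riccati.mul_rpow_le` uniform in n.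
  set U : ℝ → ℝ := fun x => ∫ t in (0 : ℝ)..x, (1 + (V t - l 0) * |t| ^ p) with hU
  have hUc : Continuous U := intervalIntegral.continuous_primitive
    (fun a b => (hci (l 0)).intervalIntegrable a b) 0
  have hup : ∀ n, ∀ x ∈ Icc (0 : ℝ) 1, w n x * |x| ^ p ≤ U x := by
    intro n x hx
    refine ((h n).mul_rpow_le hpq hV (hc n) hx).trans ?_
    refine intervalIntegral.integral_mono_on hx.1 ((hci _).intervalIntegrable _ _)
      ((hci _).intervalIntegrable _ _) fun t _ => ?_
    have := hlmono (Nat.zero_le n)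
    gcongr
  have hup' : ∀ n, ∀ x ∈ Ioc (0 : ℝ) 1, w n x ≤ U x / |x| ^ p := by
    intro n x hx
    have : 0 < |x| ^ p := Real.rpow_pos_of_pos (abs_pos.2 hx.1.ne') _
    rw [le_div_iff₀ this]
    exact hup n x ⟨hx.1.le, hx.2⟩
  -- The same bound at x = 1, where w is -α, becomes an upper bound for `l n`.
  have hlb : BddAbove (range l) := by
    refine ⟨(α + ∫ t in (0 : ℝ)..1, (1 + V t * |t| ^ p)) / ∫ t in (0 : ℝ)..1, |t| ^ p, ?_⟩
    rintro _ ⟨n, rfl⟩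
    rw [le_div_iff₀ (integral_abs_rpow_pos hp)]
    have e := (h n).mul_rpow_le hpq hV (hc n) (x := 1) (by simp)
    have e2 : (fun t => 1 + (V t - l n) * |t| ^ p) =
        fun t => (1 + V t * |t| ^ p) - l n * |t| ^ p := by
      funext t
      ring
    rw [e2, intervalIntegral.integral_sub, intervalIntegral.integral_const_mul, h1] at e
    · simp only [abs_one, Real.one_rpow] at e
      linarith
    · exact (continuous_const.add (hV.mul hcp)).intervalIntegrable _ _
    · exact (continuous_const.mul hcp).intervalIntegrable _ _
  set lam := ⨆ n, l n
  set W : ℝ → ℝ := fun x => ⨆ n, w n x with hWdef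
  have hl : Tendsto l atTop (𝓝 lam) := tendsto_atTop_ciSup hlmono hlb
  have hWb : ∀ x ∈ Ioc (0 : ℝ) 1, BddAbove (range fun n => w n x) := fun x hx =>
    ⟨_, by rintro _ ⟨n, rfl⟩; exact hup' n x hx⟩
  have hW : ∀ x ∈ Ioc (0 : ℝ) 1, Tendsto (fun n => w n x) atTop (𝓝 (W x)) := fun x hx =>
    tendsto_atTop_ciSup (hwmono x ⟨hx.1.le, hx.2⟩) (hWb x hx)
  have hWle : ∀ n, ∀ x ∈ Ioc (0 : ℝ) 1, w n x ≤ W x := fun n x hx => le_ciSup (hWb x hx) n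
  have hW1 : W 1 = -α := by simp [hWdef, h1]
  set d : ℝ → ℝ := fun x => V x - lam - (p - 1) * |W x| ^ q with hd
  -- Dominated convergence passes the integrated equation to the limit on `[s, 1]`; the derivative
  -- and the continuity of W are recovered from it afterwards.
  have hlim : ∀ s ∈ Ioc (0 : ℝ) 1,
      IntervalIntegrable d volume s 1 ∧ ∫ x in s..1, d x = W 1 - W s := by
    intro s hs
    have hsub : ∀ x ∈ Icc s 1, x ∈ Ioc (0 : ℝ) 1 := fun x hx => ⟨hs.1.trans_le hx.1, hx.2⟩
    have hsub' : ∀ x ∈ Icc s 1, x ∈ Icc (0 : ℝ) 1 := fun x hx => ⟨hs.1.le.trans hx.1, hx.2⟩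
    obtain ⟨A, hA⟩ := exists_abs_le_of_continuousOn (w := w 0) (a := s) (b := 1)
      ((hc 0).mono hsub')
    obtain ⟨A', hA'⟩ := exists_abs_le_of_continuousOn (w := fun x => U x / |x| ^ p) (a := s)
      (b := 1) (hUc.continuousOn.div hcp.continuousOn fun x hx =>
        (Real.rpow_pos_of_pos (abs_pos.2 (hsub x hx).1.ne') _).ne')
    obtain ⟨B, hB⟩ := exists_abs_le_of_continuousOn (a := s) (b := 1) hV.continuousOn
    have hwH : ∀ n, ∀ x ∈ Icc s 1, |w n x| ≤ max A A' := by
      intro n x hx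
      refine (abs_le_max_abs_abs (hwmono x (hsub' x hx) (Nat.zero_le n))
        (hup' n x (hsub x hx))).trans ?_
      exact max_le_max (hA x hx) (hA' x hx)
    have hlamle : ∀ n, |l n| ≤ max |l 0| |lam| := fun n =>
      abs_le_max_abs_abs (hlmono (Nat.zero_le n)) (le_ciSup hlb n)
    have hm : ∀ n, ContinuousOn (fun x => V x - l n - (p - 1) * |w n x| ^ q) (Icc s 1) := fun n =>
      (hV.continuousOn.sub continuousOn_const).sub (continuousOn_const.mul
        (((hc n).mono hsub').abs.rpow_const fun x _ => Or.inr (by linarith)))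
    have hpt : ∀ x ∈ Icc s 1, Tendsto (fun n => V x - l n - (p - 1) * |w n x| ^ q) atTop
        (𝓝 (d x)) := fun x hx =>
      (tendsto_const_nhds.sub hl).sub (((hW x (hsub x hx)).abs.rpow_const
        (Or.inr (by linarith))).const_mul _)
    have hbd : ∀ n, ∀ x ∈ Icc s 1, ‖V x - l n - (p - 1) * |w n x| ^ q‖ ≤
        B + max |l 0| |lam| + (p - 1) * (max A A') ^ q := by
      intro n x hx
      have hq0 : 0 ≤ q := by linarith
      have hp1 : 0 ≤ p - 1 := by linarith
      have e1 : |w n x| ^ q ≤ (max A A') ^ q := by gcongr; exact hwH n x hx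
      calc ‖V x - l n - (p - 1) * |w n x| ^ q‖
          ≤ |V x - l n| + |(p - 1) * |w n x| ^ q| := abs_sub _ _
        _ ≤ |V x| + |l n| + |(p - 1) * |w n x| ^ q| := by gcongr; exact abs_sub _ _
        _ = |V x| + |l n| + (p - 1) * |w n x| ^ q := by
          rw [abs_of_nonneg (a := (p - 1) * _) (by positivity)]
        _ ≤ _ := by gcongr; exacts [hB x hx, hlamle n]
    have hIoc : uIoc s 1 = Ioc s 1 := uIoc_of_le hs.2
    have hmeas : ∀ n, AEStronglyMeasurable (fun x => V x - l n - (p - 1) * |w n x| ^ q)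
        (volume.restrict (uIoc s 1)) := fun n => by
      rw [hIoc]
      exact ((hm n).mono Ioc_subset_Icc_self).aestronglyMeasurable measurableSet_Ioc
    have hdm : AEStronglyMeasurable d (volume.restrict (uIoc s 1)) := by
      refine aestronglyMeasurable_of_tendsto_ae atTop hmeas ?_
      rw [hIoc, ae_restrict_iff' measurableSet_Ioc]
      exact Eventually.of_forall fun x hx => hpt x (Ioc_subset_Icc_self hx)
    constructor
    · rw [hIoc] at hdm
      rw [intervalIntegrable_iff, hIoc]
      refine Integrable.of_bound hdm (B + max |l 0| |lam| + (p - 1) * (max A A') ^ q) ?_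
      rw [ae_restrict_iff' measurableSet_Ioc]
      refine Eventually.of_forall fun x hx => ?_
      exact le_of_tendsto (hpt x (Ioc_subset_Icc_self hx)).norm
        (Eventually.of_forall fun n => hbd n x (Ioc_subset_Icc_self hx))
    · have t1 : Tendsto (fun n => ∫ x in s..1, V x - l n - (p - 1) * |w n x| ^ q) atTop
          (𝓝 (∫ x in s..1, d x)) := by
        refine intervalIntegral.tendsto_integral_filter_of_dominated_convergence
          (fun _ => B + max |l 0| |lam| + (p - 1) * (max A A') ^ q) (Eventually.of_forall hmeas)
          ?_ (by simp) ?_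
        · refine Eventually.of_forall fun n => Eventually.of_forall fun x hx => ?_
          rw [hIoc] at hx
          exact hbd n x (Ioc_subset_Icc_self hx)
        · refine Eventually.of_forall fun x hx => ?_
          rw [hIoc] at hx
          exact hpt x (Ioc_subset_Icc_self hx)
      have t2 : Tendsto (fun n => w n 1 - w n s) atTop (𝓝 (W 1 - W s)) :=
        (hW 1 (by simp)).sub (hW s hs)
      refine tendsto_nhds_unique t1 (t2.congr fun n => ?_)
      exact ((h n).eq_integral hq (by fun_prop) (hc n) s (hsub' s (left_mem_Icc.2 hs.2)) 1
        (by simp) hs.2).symm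
  have hWc : ContinuousOn W (Ioc 0 1) := by
    intro x hx
    have hs : x / 2 ∈ Ioc (0 : ℝ) 1 := ⟨by linarith [hx.1], by linarith [hx.1, hx.2]⟩
    have hcont := (((hlim _ hs).1.symm).absolutelyContinuousOnInterval_intervalIntegral (c := 1)
      (by simp)).continuousOn
    rw [uIcc_of_ge hs.2] at hcont
    have : ContinuousOn W (Icc (x / 2) 1) := by
      refine ((continuousOn_const (c := W 1)).add hcont).congr fun y hy => ?_
      have := (hlim y ⟨by linarith [hx.1, hy.1], hy.2⟩).2
      simp only [Pi.add_apply]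
      rw [intervalIntegral.integral_symm, this]
      ring
    refine (this x ⟨by linarith [hx.1], hx.2⟩).mono_of_mem_nhdsWithin ?_
    refine mem_nhdsWithin.2 ⟨Ioi (x / 2), isOpen_Ioi, by simp only [mem_Ioi]; linarith [hx.1], ?_⟩
    rintro y ⟨hy1, hy2⟩
    exact ⟨le_of_lt hy1, hy2.2⟩
  have hdc : ContinuousOn d (Ioc 0 1) :=
    (hV.continuousOn.sub continuousOn_const).sub (continuousOn_const.mul
      (hWc.abs.rpow_const fun x _ => Or.inr (by linarith)))
  refine ⟨lam, W, ?_, hWc, ?_, hW1, ?_⟩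
  · intro x hx
    have hnhds : Ioo (0 : ℝ) 1 ∈ 𝓝 x := Ioo_mem_nhds hx.1 hx.2
    have hda : ContinuousAt d x :=
      (hdc.mono Ioo_subset_Ioc_self).continuousAt hnhds
    have e := intervalIntegral.integral_hasDerivAt_left (hlim x ⟨hx.1, hx.2.le⟩).1
      ((hdc.mono Ioo_subset_Ioc_self).stronglyMeasurableAtFilter isOpen_Ioo x hx) hda
    have e2 := e.const_sub (W 1)
    rw [neg_neg] at e2
    refine e2.congr_of_eventuallyEq ?_
    filter_upwards [hnhds] with y hy
    rw [(hlim y ⟨hy.1, hy.2.le⟩).2]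
    ring
  · rw [tendsto_atTop]
    intro b
    obtain ⟨n, hn⟩ := exists_nat_gt b
    have e : Tendsto (w n) (𝓝[>] 0) (𝓝 n) := by
      have := (hc n 0 (by simp))
      rw [ContinuousWithinAt, h0] at this
      exact this.mono_left (nhdsWithin_le_of_mem (mem_of_superset (Ioc_mem_nhdsGT one_pos)
        Ioc_subset_Icc_self))
    filter_upwards [e.eventually (lt_mem_nhds hn), Ioc_mem_nhdsGT one_pos] with x hx1 hx2
    exact hx1.le.trans (hWle n x hx2)
  -- W is infinite at 0, so Picone's inequality is not applied to it directly. The bound holds for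
  -- each n, as `f 0 = 0` kills the term at 0, and passes to the limit.
  · intro f g hf hf0
    refine le_of_tendsto (hl.mul_const _) (Eventually.of_forall fun n => ?_)
    exact (h n).mul_halfMass_le hpq hV (hc n) (h1 n) hf (by simp [hf0, Real.zero_rpow hpq.ne_zero])

/-! ### Eigenfunctions on `[0, 1]` -/

/-- The map `x ↦ |x|^{q-2} x`. -/
def signedPow (q x : ℝ) : ℝ := |x| ^ (q - 2) * x

/-- The map is the derivative of `|x|^q / q`, which is C¹. This covers q < 2, where the factor
`|x|^{q-2}` alone is singular at 0. -/
theorem continuous_signedPow {q : ℝ} (hq : 1 < q) : Continuous (signedPow q) := by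
  have hc : ContDiff ℝ 1 (fun x : ℝ => ‖x‖ ^ q) := contDiff_norm_rpow hq
  have h1 := (hc.continuous_deriv le_rfl).const_mul (q⁻¹)
  have h2 : (fun x => q⁻¹ * deriv (fun x : ℝ => ‖x‖ ^ q) x) = signedPow q := by
    funext x
    rw [(hasDerivAt_norm_rpow x hq).deriv, signedPow, Real.norm_eq_abs]
    have : q ≠ 0 := by linarith
    field_simp
  rwa [h2] at h1

theorem abs_signedPow {q : ℝ} (hq : 1 < q) (x : ℝ) : |signedPow q x| = |x| ^ (q - 1) :=
  abs_abs_rpow_sub_two_mul hq x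

theorem signedPow_of_pos {q x : ℝ} (hx : 0 < x) : signedPow q x = x ^ (q - 1) := by
  rw [signedPow, abs_of_pos hx, ← Real.rpow_add_one hx.ne']
  ring_nf

theorem signedPow_of_nonneg {q x : ℝ} (hq : 1 < q) (hx : 0 ≤ x) :
    signedPow q x = x ^ (q - 1) := by
  rcases hx.eq_or_lt with rfl | hx
  · simp [signedPow, Real.zero_rpow (by linarith : q - 1 ≠ 0)]
  · exact signedPow_of_pos hx

theorem signedPow_neg {q x : ℝ} : signedPow q (-x) = -signedPow q x := by
  simp [signedPow]

theorem signedPow_mono {q : ℝ} (hq : 1 < q) : Monotone (signedPow q) := by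
  have hnn : ∀ x y, 0 ≤ x → x ≤ y → signedPow q x ≤ signedPow q y := fun x y hx hxy => by
    rw [signedPow_of_nonneg hq hx, signedPow_of_nonneg hq (hx.trans hxy)]
    exact Real.rpow_le_rpow hx hxy (by linarith)
  have h0 : signedPow q 0 = 0 := by simp [signedPow]
  intro x y hxy
  rcases le_total 0 x with hx | hx
  · exact hnn x y hx hxy
  rcases le_total 0 y with hy | hy
  · have h1 := hnn 0 y le_rfl hy
    have h2 := hnn 0 (-x) le_rfl (by linarith)
    rw [signedPow_neg] at h2
    linarith
  · have := hnn (-y) (-x) (by linarith) (by linarith)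
    rw [signedPow_neg, signedPow_neg] at this
    linarith

theorem signedPow_mul_self {q : ℝ} (hq : 1 < q) (x : ℝ) : signedPow q x * x = |x| ^ q := by
  rcases eq_or_ne x 0 with rfl | h
  · simp [Real.zero_rpow (by linarith : q ≠ 0)]
  · rw [signedPow, mul_assoc, ← abs_mul_abs_self x, ← mul_assoc,
      ← Real.rpow_add_one (abs_ne_zero.2 h), ← Real.rpow_add_one (abs_ne_zero.2 h)]
    ring_nf

theorem signedPow_mul {q x y : ℝ} : signedPow q (x * y) = signedPow q x * signedPow q y := by
  simp only [signedPow, abs_mul, Real.mul_rpow (abs_nonneg x) (abs_nonneg y)]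
  ring

theorem signedPow_mul_of_abs_eq_one {p s x : ℝ} (hs : |s| = 1) :
    signedPow p (s * x) = s * signedPow p x := by
  rw [signedPow_mul, signedPow, hs, Real.one_rpow, one_mul]

theorem signedPow_signedPow {p q : ℝ} (hpq : p.HolderConjugate q) (x : ℝ) :
    signedPow p (signedPow q x) = x := by
  rcases eq_or_ne x 0 with rfl | h
  · simp [signedPow]
  · rw [signedPow, abs_signedPow hpq.symm.lt, signedPow, ← Real.rpow_mul (abs_nonneg _),
      ← mul_assoc, ← Real.rpow_add (abs_pos.2 h)]
    have h1 := hpq.mul_eq_add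
    have : (q - 1) * (p - 2) + (q - 2) = 0 := by linarith
    rw [this, Real.rpow_zero, one_mul]

/-- `u` is a positive solution on `(0, 1]` of the eigenvalue equation with the Robin condition at
`1` whose flux is `w u^{p-1}`. -/
structure HalfEigen (p q α : ℝ) (V : ℝ → ℝ) (lam : ℝ) (w u : ℝ → ℝ) : Prop where
  riccati : Riccati p q (fun x => V x - lam) w 0 1
  continuousOn : ContinuousOn w (Ioc 0 1)
  apply_one : w 1 = -α
  continuousOn_fun : ContinuousOn u (Icc 0 1)
  pos : ∀ x ∈ Ioc (0 : ℝ) 1, 0 < u x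
  hasDerivAt : ∀ x ∈ Ioo (0 : ℝ) 1, HasDerivAt u (signedPow q (w x) * u x) x
  flux_bounded : ∃ C, ∀ x ∈ Ioc (0 : ℝ) 1, |w x * u x ^ (p - 1)| ≤ C

/-- The function is the exponential of the primitive of r based at 1; in the Dirichlet case r is the
logarithmic derivative of a function vanishing at 0, so it need not be integrable there. -/
theorem exists_exp_primitive {r : ℝ → ℝ} (hr : ContinuousOn r (Ioc 0 1)) :
    ∃ u : ℝ → ℝ, (∀ x, 0 < u x) ∧ ContinuousOn u (Ioc 0 1) ∧
      (∀ x ∈ Ioo (0 : ℝ) 1, HasDerivAt u (r x * u x) x) ∧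
      (ContinuousOn r (Icc 0 1) → ContinuousOn u (Icc 0 1)) := by
  have hint : ∀ s, 0 < s → s ≤ 1 → IntervalIntegrable r volume 1 s := by
    intro s hs hs1
    apply ContinuousOn.intervalIntegrable
    rw [uIcc_of_ge hs1]
    exact hr.mono fun x hx => ⟨hs.trans_le hx.1, hx.2⟩
  have hcon : ∀ s, s ≤ 1 → IntervalIntegrable r volume 1 s →
      ContinuousOn (fun x => Real.exp (∫ t in (1 : ℝ)..x, r t)) (Icc s 1) := by
    intro s hs h
    have := (h.absolutelyContinuousOnInterval_intervalIntegral (c := 1) (by simp)).continuousOn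
    rw [uIcc_of_ge hs] at this
    exact this.rexp
  refine ⟨fun x => Real.exp (∫ t in (1 : ℝ)..x, r t), fun x => Real.exp_pos _, ?_, ?_, ?_⟩
  · intro x hx
    have := hcon (x / 2) (by linarith [hx.1, hx.2])
      (hint _ (by linarith [hx.1]) (by linarith [hx.1, hx.2]))
    refine (this x ⟨by linarith [hx.1], hx.2⟩).mono_of_mem_nhdsWithin ?_
    refine mem_nhdsWithin.2 ⟨Ioi (x / 2), isOpen_Ioi, by simp only [mem_Ioi]; linarith [hx.1], ?_⟩
    rintro y ⟨hy1, hy2⟩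
    exact ⟨le_of_lt hy1, hy2.2⟩
  · intro x hx
    have hnhds : Ioo (0 : ℝ) 1 ∈ 𝓝 x := Ioo_mem_nhds hx.1 hx.2
    have hro := hr.mono Ioo_subset_Ioc_self
    have e := intervalIntegral.integral_hasDerivAt_right (hint x hx.1 hx.2.le)
      (hro.stronglyMeasurableAtFilter isOpen_Ioo x hx) (hro.continuousAt hnhds)
    rw [mul_comm]
    exact e.exp
  · intro hr'
    refine hcon 0 zero_le_one (ContinuousOn.intervalIntegrable ?_)
    rwa [uIcc_of_ge zero_le_one]

theorem NeumannRiccati.exists_halfEigen {p q α lam : ℝ} (hpq : p.HolderConjugate q) {V w : ℝ → ℝ}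
    (h : NeumannRiccati p q α V lam w) :
    ∃ u, HalfEigen p q α V lam w u ∧ 0 < u 0 := by
  have hr : ContinuousOn (fun x => signedPow q (w x)) (Icc 0 1) :=
    (continuous_signedPow hpq.symm.lt).comp_continuousOn h.continuousOn
  obtain ⟨u, hpos, -, hd, hc⟩ := exists_exp_primitive (hr.mono Ioc_subset_Icc_self)
  refine ⟨u, ⟨h.riccati, h.continuousOn.mono Ioc_subset_Icc_self, h.apply_one, hc hr,
    fun x _ => hpos x, hd, ?_⟩, hpos 0⟩
  have : ContinuousOn (fun x => w x * u x ^ (p - 1)) (Icc 0 1) :=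
    h.continuousOn.mul ((hc hr).rpow_const fun x _ => Or.inl (hpos x).ne')
  obtain ⟨C, hC⟩ := exists_abs_le_of_continuousOn this
  exact ⟨C, fun x hx => hC x (Ioc_subset_Icc_self hx)⟩

/-- The Riccati term `-(p - 1)|w|^q u^{p-1}` cancels against the derivative of `u^{p-1}`, which
returns the original second-order equation in flux form. -/
theorem hasDerivAt_flux {p q : ℝ} (hpq : p.HolderConjugate q) {c w u : ℝ → ℝ} {x : ℝ}
    (hw : HasDerivAt w (c x - (p - 1) * |w x| ^ q) x) (hu : 0 < u x)
    (hu' : HasDerivAt u (signedPow q (w x) * u x) x) :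
    HasDerivAt (fun x => w x * u x ^ (p - 1)) (c x * u x ^ (p - 1)) x := by
  have h1 := hu'.rpow_const (p := p - 1) (Or.inl hu.ne')
  convert! hw.mul h1 using 1
  have h2 : u x ^ (p - 1) = u x * u x ^ (p - 1 - 1) := by
    rw [Real.rpow_sub_one hu.ne' (p - 1)]
    field_simp
  rw [h2, ← signedPow_mul_self hpq.symm.lt]
  ring

theorem DirichletRiccati.exists_halfEigen {p q α lam : ℝ} (hpq : p.HolderConjugate q)
    {V w : ℝ → ℝ} (hV : Continuous V) (h : DirichletRiccati p q α V lam w) :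
    ∃ v, HalfEigen p q α V lam w v ∧ v 0 = 0 := by
  have hp := hpq.lt
  have hp1 : 0 < p - 1 := by linarith
  have hr : ContinuousOn (fun x => signedPow q (w x)) (Ioc 0 1) :=
    (continuous_signedPow hpq.symm.lt).comp_continuousOn h.continuousOn
  obtain ⟨u, hpos, hc, hd, -⟩ := exists_exp_primitive hr
  -- `u` is bounded, since it is monotone near `0`
  obtain ⟨δ, hδ0, hδ⟩ : ∃ δ, 0 < δ ∧ ∀ x ∈ Ioo (0 : ℝ) δ, 0 < w x := by
    have := h.tendsto.eventually (eventually_gt_atTop 0)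
    obtain ⟨δ, hδ, hs⟩ := mem_nhdsGT_iff_exists_Ioo_subset.1 this
    exact ⟨δ, hδ, hs⟩
  set ε := min δ 1 with hε
  have hε0 : 0 < ε := lt_min hδ0 one_pos
  have hε1 : ε ≤ 1 := min_le_right _ _
  have hmono : MonotoneOn u (Ioc 0 ε) := by
    apply monotoneOn_of_deriv_nonneg (convex_Ioc _ _)
      (hc.mono (Ioc_subset_Ioc_right hε1))
    · rw [interior_Ioc]
      exact fun x hx => (hd x ⟨hx.1, hx.2.trans_le hε1⟩).differentiableAt.differentiableWithinAt
    · rw [interior_Ioc]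
      intro x hx
      rw [(hd x ⟨hx.1, hx.2.trans_le hε1⟩).deriv,
        signedPow_of_pos (hδ x ⟨hx.1, hx.2.trans_le (min_le_left _ _)⟩)]
      have := hδ x ⟨hx.1, hx.2.trans_le (min_le_left _ _)⟩
      have := hpos x
      positivity
  obtain ⟨A, hA⟩ := exists_abs_le_of_continuousOn (w := u) (a := ε) (b := 1)
    (hc.mono fun x hx => ⟨hε0.trans_le hx.1, hx.2⟩)
  have hub : ∀ x ∈ Ioc (0 : ℝ) 1, u x ≤ A := by
    intro x hx
    rcases le_total x ε with hx' | hx'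
    · exact (hmono ⟨hx.1, hx'⟩ ⟨hε0, le_rfl⟩ hx').trans
        ((le_abs_self _).trans (hA ε ⟨le_rfl, hε1⟩))
    · exact (le_abs_self _).trans (hA x ⟨hx', hx.2⟩)
  obtain ⟨B, hB⟩ := exists_abs_le_of_continuousOn (w := fun x => V x - lam) (a := 0) (b := 1)
    (by fun_prop)
  have hB0 : 0 ≤ B := (abs_nonneg _).trans (hB 0 (by simp))
  set y : ℝ → ℝ := fun x => w x * u x ^ (p - 1) with hy
  have hyd : ∀ x ∈ Ioo (0 : ℝ) 1, HasDerivAt y ((V x - lam) * u x ^ (p - 1)) x := fun x hx =>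
    hasDerivAt_flux hpq (c := fun x => V x - lam) (h.riccati x hx) (hpos x) (hd x hx)
  have hyc : ContinuousOn y (Ioc 0 1) :=
    h.continuousOn.mul (hc.rpow_const fun x _ => Or.inl (hpos x).ne')
  -- The flux has derivative `(V - lam) u^{p-1}`, bounded because u is; the mean value theorem on
  -- `[x, 1]` then bounds the flux itself.
  have hyb : ∀ x ∈ Ioc (0 : ℝ) 1, |y x| ≤ |y 1| + B * A ^ (p - 1) := by
    intro x hx
    rcases hx.2.eq_or_lt with rfl | hx1
    · have : 0 ≤ A ^ (p - 1) := Real.rpow_nonneg ((hpos 1).le.trans (hub 1 (by simp))) _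
      nlinarith
    obtain ⟨t, ht, e⟩ := exists_hasDerivAt_eq_slope y _ hx1
      (hyc.mono fun z hz => ⟨hx.1.trans_le hz.1, hz.2⟩)
      (fun z hz => hyd z ⟨hx.1.trans hz.1, hz.2⟩)
    have ht' : t ∈ Ioc (0 : ℝ) 1 := ⟨hx.1.trans ht.1, ht.2.le⟩
    rw [eq_div_iff (by linarith)] at e
    have e1 : |y 1 - y x| ≤ B * A ^ (p - 1) := by
      rw [← e, abs_mul, abs_mul, abs_of_pos (a := 1 - x) (by linarith),
        abs_of_nonneg (a := u t ^ (p - 1)) (Real.rpow_nonneg (hpos t).le _)]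
      have e2 := hB t (Ioc_subset_Icc_self ht')
      have e3 : u t ^ (p - 1) ≤ A ^ (p - 1) :=
        Real.rpow_le_rpow (hpos t).le (hub t ht') hp1.le
      have e4 : 0 ≤ u t ^ (p - 1) := Real.rpow_nonneg (hpos t).le _
      calc |V t - lam| * u t ^ (p - 1) * (1 - x) ≤ |V t - lam| * u t ^ (p - 1) * 1 := by
            gcongr; linarith [hx.1]
        _ ≤ _ := by rw [mul_one]; gcongr
    have e5 := abs_sub_abs_le_abs_sub (y x) (y 1)
    rw [abs_sub_comm] at e5
    linarith
  -- Here `u^{p-1}` is the quotient of the bounded flux by w, and w tends to infinity.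
  have hlim : Tendsto u (𝓝[>] 0) (𝓝 0) := by
    set M := |y 1| + B * A ^ (p - 1)
    have t1 : Tendsto (fun x => (M / w x) ^ (p - 1)⁻¹) (𝓝[>] 0) (𝓝 0) := by
      have := (h.tendsto.const_div_atTop M).rpow_const (p := (p - 1)⁻¹)
        (Or.inr (inv_pos.2 hp1).le)
      rwa [Real.zero_rpow (inv_pos.2 hp1).ne'] at this
    refine tendsto_of_tendsto_of_tendsto_of_le_of_le' tendsto_const_nhds t1
      (Eventually.of_forall fun x => (hpos x).le) ?_
    filter_upwards [h.tendsto.eventually (eventually_gt_atTop 0), Ioc_mem_nhdsGT one_pos]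
      with x hx1 hx2
    have e1 : u x ^ (p - 1) ≤ M / w x := by
      rw [le_div_iff₀ hx1, mul_comm]
      exact (le_abs_self _).trans (hyb x hx2)
    calc u x = (u x ^ (p - 1)) ^ (p - 1)⁻¹ := (Real.rpow_rpow_inv (hpos x).le hp1.ne').symm
      _ ≤ _ := Real.rpow_le_rpow (Real.rpow_nonneg (hpos x).le _) e1 (inv_pos.2 hp1).le
  -- The formula for u gives a positive value at 0; it is replaced by the limit.
  set v : ℝ → ℝ := Function.update u 0 0
  have hvu : ∀ x ∈ Ioc (0 : ℝ) 1, v x = u x := fun x hx => Function.update_of_ne hx.1.ne' _ _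
  refine ⟨v, ⟨h.riccati, h.continuousOn, h.apply_one, ?_,
    fun x hx => by rw [hvu x hx]; exact hpos x, ?_,
    ⟨_, fun x hx => by rw [hvu x hx]; exact hyb x hx⟩⟩, Function.update_self ..⟩
  · intro x hx
    rcases hx.1.eq_or_lt with rfl | hx0
    · rw [continuousWithinAt_update_same]
      refine hlim.mono_left (nhdsWithin_mono _ ?_)
      rintro z ⟨hz1, hz2⟩
      exact lt_of_le_of_ne hz1.1 (Ne.symm hz2)
    · rw [continuousWithinAt_update_of_ne hx0.ne']
      refine (hc x ⟨hx0, hx.2⟩).mono_of_mem_nhdsWithin ?_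
      refine mem_nhdsWithin.2 ⟨Ioi 0, isOpen_Ioi, hx0, ?_⟩
      rintro z ⟨hz1, hz2⟩
      exact ⟨hz1, hz2.2⟩
  · intro x hx
    rw [hvu x (Ioo_subset_Ioc_self hx)]
    refine (hd x hx).congr_of_eventuallyEq ?_
    filter_upwards [Ioo_mem_nhds hx.1 hx.2] with z hz
    exact hvu z (Ioo_subset_Ioc_self hz)

/-! ### Energy identities for eigenfunctions on `[0, 1]` -/

namespace HalfEigen

variable {p q α lam : ℝ} {V w u : ℝ → ℝ}

theorem signedPow_deriv (hpq : p.HolderConjugate q) (h : HalfEigen p q α V lam w u) {x : ℝ}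
    (hx : x ∈ Ioc (0 : ℝ) 1) : signedPow p (signedPow q (w x) * u x) = w x * u x ^ (p - 1) := by
  rw [signedPow_mul, signedPow_signedPow hpq, signedPow_of_pos (h.pos x hx)]

theorem continuousOn_deriv (hpq : p.HolderConjugate q) (h : HalfEigen p q α V lam w u) :
    ContinuousOn (fun x => signedPow q (w x) * u x) (Ioc 0 1) :=
  ((continuous_signedPow hpq.symm.lt).comp_continuousOn h.continuousOn).mul
    (h.continuousOn_fun.mono Ioc_subset_Icc_self)

theorem deriv_bounded (hpq : p.HolderConjugate q) (h : HalfEigen p q α V lam w u) :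
    ∃ C, ∀ x ∈ Ioc (0 : ℝ) 1, |signedPow q (w x) * u x| ≤ C := by
  obtain ⟨C, hC⟩ := h.flux_bounded
  have hp1 : 0 < p - 1 := by linarith [hpq.lt]
  refine ⟨C ^ (p - 1)⁻¹, fun x hx => ?_⟩
  have h1 := hC x hx
  rw [← h.signedPow_deriv hpq hx, abs_signedPow hpq.lt] at h1
  rw [← Real.rpow_rpow_inv (abs_nonneg (signedPow q (w x) * u x)) hp1.ne']
  exact Real.rpow_le_rpow (by positivity) h1 (inv_pos.2 hp1).le

theorem intervalIntegrable_of_bounded {f : ℝ → ℝ} {C : ℝ} (hf : ContinuousOn f (Ioc 0 1))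
    (hC : ∀ x ∈ Ioc (0 : ℝ) 1, |f x| ≤ C) : IntervalIntegrable f volume 0 1 := by
  rw [intervalIntegrable_iff, uIoc_of_le zero_le_one]
  refine Integrable.of_bound (hf.aestronglyMeasurable measurableSet_Ioc) C ?_
  rw [ae_restrict_iff' measurableSet_Ioc]
  exact Eventually.of_forall hC

theorem halfSobolev (hpq : p.HolderConjugate q) (h : HalfEigen p q α V lam w u) :
    HalfSobolev p u (fun x => signedPow q (w x) * u x) := by
  obtain ⟨C, hC⟩ := h.deriv_bounded hpq
  have hc := h.continuousOn_deriv hpq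
  have hint := intervalIntegrable_of_bounded hc hC
  refine ⟨hint, ?_, ?_⟩
  · refine intervalIntegrable_of_bounded (C := C ^ p)
      (hc.abs.rpow_const fun x _ => Or.inr hpq.nonneg) fun x hx => ?_
    rw [abs_of_nonneg (by positivity)]
    exact Real.rpow_le_rpow (abs_nonneg _) (hC x hx) hpq.nonneg
  · intro x hx
    have := intervalIntegral.integral_eq_sub_of_hasDerivAt_of_le hx.1
      (h.continuousOn_fun.mono (Icc_subset_Icc_right hx.2))
      (fun t ht => h.hasDerivAt t ⟨ht.1, ht.2.trans_le hx.2⟩)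
      (hint.mono_set (by
        rw [uIcc_of_le hx.1, uIcc_of_le zero_le_one]
        exact Icc_subset_Icc_right hx.2))
    rw [this]
    ring

theorem continuousOn_flux (h : HalfEigen p q α V lam w u) :
    ContinuousOn (fun x => w x * u x ^ (p - 1)) (Ioc 0 1) :=
  h.continuousOn.mul ((h.continuousOn_fun.mono Ioc_subset_Icc_self).rpow_const
    fun x hx => Or.inl (h.pos x hx).ne')

/-- The weak form of the eigenvalue equation on `[0, 1]`. -/
theorem integral_flux (hpq : p.HolderConjugate q) (hV : Continuous V)
    (h : HalfEigen p q α V lam w u) {η η' : ℝ → ℝ} (hη : ContinuousOn η (Icc 0 1))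
    (hη' : ∀ x ∈ Ioo (0 : ℝ) 1, HasDerivAt η (η' x) x)
    (hi : IntervalIntegrable η' volume 0 1)
    (h0 : Tendsto (fun x => w x * u x ^ (p - 1) * η x) (𝓝[>] 0) (𝓝 0)) :
    ∫ x in (0 : ℝ)..1, (w x * u x ^ (p - 1) * η' x + (V x - lam) * u x ^ (p - 1) * η x) =
      -α * u 1 ^ (p - 1) * η 1 := by
  have hp1 : 0 < p - 1 := by linarith [hpq.lt]
  -- In the Dirichlet case w has no meaningful value at 0, so flux times η is given its limit 0
  -- there before the fundamental theorem of calculus is applied.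
  set Z : ℝ → ℝ := Function.update (fun x => w x * u x ^ (p - 1) * η x) 0 0 with hZ
  have hZe : ∀ x, x ≠ 0 → Z x = w x * u x ^ (p - 1) * η x := fun x hx =>
    Function.update_of_ne hx _ _
  have hZc : ContinuousOn Z (Icc 0 1) := by
    intro x hx
    rcases hx.1.eq_or_lt with rfl | hx0
    · rw [continuousWithinAt_update_same]
      refine h0.mono_left (nhdsWithin_mono _ ?_)
      rintro z ⟨hz1, hz2⟩
      exact lt_of_le_of_ne hz1.1 (Ne.symm hz2)
    · rw [continuousWithinAt_update_of_ne hx0.ne']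
      refine ((h.continuousOn_flux.mul (hη.mono Ioc_subset_Icc_self))
        x ⟨hx0, hx.2⟩).mono_of_mem_nhdsWithin ?_
      refine mem_nhdsWithin.2 ⟨Ioi 0, isOpen_Ioi, hx0, ?_⟩
      rintro z ⟨hz1, hz2⟩
      exact ⟨hz1, hz2.2⟩
  have hu1 : ContinuousOn (fun x => u x ^ (p - 1)) (Icc 0 1) :=
    h.continuousOn_fun.rpow_const fun _ _ => Or.inr hp1.le
  obtain ⟨C, hC⟩ := h.flux_bounded
  have hint : IntervalIntegrable (fun x => w x * u x ^ (p - 1) * η' x +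
      (V x - lam) * u x ^ (p - 1) * η x) volume 0 1 := by
    refine IntervalIntegrable.add ?_ ?_
    · rw [intervalIntegrable_iff, uIoc_of_le zero_le_one] at hi ⊢
      refine hi.bdd_mul (c := C) (h.continuousOn_flux.aestronglyMeasurable measurableSet_Ioc) ?_
      rw [ae_restrict_iff' measurableSet_Ioc]
      exact Eventually.of_forall hC
    · apply ContinuousOn.intervalIntegrable
      rw [uIcc_of_le zero_le_one]
      exact ((hV.continuousOn.sub continuousOn_const).mul hu1).mul hη
  have key := intervalIntegral.integral_eq_sub_of_hasDerivAt_of_le zero_le_one hZc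
    (f' := fun x => w x * u x ^ (p - 1) * η' x + (V x - lam) * u x ^ (p - 1) * η x) ?_ hint
  · rw [key, hZe 1 one_ne_zero, h.apply_one]
    simp [hZ]
  · intro x hx
    have hx' := Ioo_subset_Ioc_self hx
    have h1 := (hasDerivAt_flux hpq (c := fun x => V x - lam) (h.riccati x hx) (h.pos x hx')
      (h.hasDerivAt x hx)).mul
      (hη' x hx)
    refine HasDerivAt.congr_of_eventuallyEq ?_ (f := fun x => w x * u x ^ (p - 1) * η x) ?_
    · convert! h1 using 1
      ring
    · filter_upwards [Ioo_mem_nhds hx.1 hx.2] with z hz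
      exact hZe z hz.1.ne'

/-- The weak equation is tested with the eigenfunction itself. -/
theorem halfEnergy_eq (hpq : p.HolderConjugate q) (hV : Continuous V)
    (h : HalfEigen p q α V lam w u)
    (h0 : Tendsto (fun x => w x * u x ^ (p - 1) * u x) (𝓝[>] 0) (𝓝 0)) :
    halfEnergy p α V u (fun x => signedPow q (w x) * u x) = lam * halfMass p u := by
  have hs := h.halfSobolev hpq
  have h1 := h.integral_flux hpq hV h.continuousOn_fun h.hasDerivAt hs.integrable h0
  have h2 := hs.halfEnergy_sub_const (α := α) hpq.lt hV lam
  rw [halfEnergy] at h2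
  have h3 : ∫ x in (0 : ℝ)..1, |signedPow q (w x) * u x| ^ p + (V x - lam) * |u x| ^ p =
      ∫ x in (0 : ℝ)..1, (w x * u x ^ (p - 1) * (signedPow q (w x) * u x) +
        (V x - lam) * u x ^ (p - 1) * u x) := by
    apply intervalIntegral.integral_congr_ae
    refine Eventually.of_forall fun x hx => ?_
    rw [uIoc_of_le zero_le_one] at hx
    have hu := h.pos x hx
    rw [← signedPow_mul_self hpq.lt, ← signedPow_mul_self hpq.lt, h.signedPow_deriv hpq hx,
      signedPow_of_pos hu]
    ring
  have hu := h.pos 1 (by simp)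
  have h4 : |u 1| ^ p = u 1 ^ (p - 1) * u 1 := by
    rw [← signedPow_mul_self hpq.lt, signedPow_of_pos hu]
  rw [h3, h1, h4] at h2
  linarith

theorem tendsto_flux_mul_of_apply_zero (h : HalfEigen p q α V lam w u) {η : ℝ → ℝ}
    (hη : ContinuousOn η (Icc 0 1)) (hη0 : η 0 = 0) :
    Tendsto (fun x => w x * u x ^ (p - 1) * η x) (𝓝[>] 0) (𝓝 0) := by
  obtain ⟨C, hC⟩ := h.flux_bounded
  have h1 : Tendsto η (𝓝[>] 0) (𝓝 0) := by
    have := hη 0 (by simp)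
    rw [ContinuousWithinAt, hη0] at this
    exact this.mono_left (nhdsWithin_le_of_mem (mem_of_superset (Ioc_mem_nhdsGT one_pos)
      Ioc_subset_Icc_self))
  have h2 : Tendsto (fun x => C * |η x|) (𝓝[>] 0) (𝓝 0) := by
    simpa using (h1.abs).const_mul C
  refine squeeze_zero_norm' ?_ h2
  filter_upwards [Ioc_mem_nhdsGT one_pos] with x hx
  rw [norm_mul]
  exact mul_le_mul_of_nonneg_right (hC x hx) (abs_nonneg _)

theorem tendsto_flux_mul_of_neumann (hpq : p.HolderConjugate q) (h : HalfEigen p q α V lam w u)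
    (hw : NeumannRiccati p q α V lam w) {η : ℝ → ℝ} (hη : ContinuousOn η (Icc 0 1)) :
    Tendsto (fun x => w x * u x ^ (p - 1) * η x) (𝓝[>] 0) (𝓝 0) := by
  have h1 : ContinuousOn (fun x => w x * u x ^ (p - 1) * η x) (Icc 0 1) :=
    (hw.continuousOn.mul (h.continuousOn_fun.rpow_const
      fun _ _ => Or.inr (by linarith [hpq.lt]))).mul hη
  have := h1 0 (by simp)
  rw [ContinuousWithinAt, hw.apply_zero, zero_mul, zero_mul] at this
  exact this.mono_left (nhdsWithin_le_of_mem (mem_of_superset (Ioc_mem_nhdsGT one_pos)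
    Ioc_subset_Icc_self))

theorem halfMass_pos (hpq : p.HolderConjugate q) (h : HalfEigen p q α V lam w u) :
    0 < halfMass p u := by
  refine intervalIntegral.intervalIntegral_pos_of_pos_on
    ((h.halfSobolev hpq).intervalIntegrable_rpow hpq.lt) (fun x hx => ?_) one_pos
  have := h.pos x (Ioo_subset_Ioc_self hx)
  positivity

end HalfEigen

/-! ### Monotonicity of the gap on `[0, 1]` -/

/-- A weighted Chebyshev inequality with its equality case. -/
theorem chebyshev_weighted {Q k ρ : ℝ → ℝ} (hQ : MonotoneOn Q (Icc 0 1))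
    (hQc : ContinuousOn Q (Icc 0 1)) (hk : MonotoneOn k (Icc 0 1))
    (hkc : ContinuousOn k (Icc 0 1)) (hρc : ContinuousOn ρ (Icc 0 1))
    (hρ : ∀ x ∈ Icc (0 : ℝ) 1, 0 < ρ x) (hk0 : k 0 = 0) (hkpos : ∀ x ∈ Ioc (0 : ℝ) 1, 0 < k x) :
    (∫ x in (0 : ℝ)..1, Q x * ρ x) / (∫ x in (0 : ℝ)..1, ρ x) ≤
        (∫ x in (0 : ℝ)..1, Q x * (k x * ρ x)) / (∫ x in (0 : ℝ)..1, k x * ρ x) ∧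
      ((∫ x in (0 : ℝ)..1, Q x * ρ x) / (∫ x in (0 : ℝ)..1, ρ x) =
        (∫ x in (0 : ℝ)..1, Q x * (k x * ρ x)) / (∫ x in (0 : ℝ)..1, k x * ρ x) → Q 0 = Q 1) := by
  have hii : ∀ {f : ℝ → ℝ}, ContinuousOn f (Icc 0 1) → IntervalIntegrable f volume 0 1 := by
    intro f hf
    apply ContinuousOn.intervalIntegrable
    rwa [uIcc_of_le zero_le_one]
  have hzero : ∀ {f : ℝ → ℝ}, ContinuousOn f (Icc 0 1) → (∀ x ∈ Icc (0 : ℝ) 1, 0 ≤ f x) →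
      ∫ x in (0 : ℝ)..1, f x = 0 → ∀ x ∈ Icc (0 : ℝ) 1, f x = 0 := by
    intro f hf hnn h0 x hx
    by_contra hne
    have := intervalIntegral.integral_pos one_pos hf (fun y hy => hnn y (Ioc_subset_Icc_self hy))
      ⟨x, hx, lt_of_le_of_ne (hnn x hx) (Ne.symm hne)⟩
    linarith
  have h0 : (0 : ℝ) ∈ Icc (0 : ℝ) 1 := by simp
  have h1 : (1 : ℝ) ∈ Icc (0 : ℝ) 1 := by simp
  set R := ∫ x in (0 : ℝ)..1, ρ x with hR
  set S := ∫ x in (0 : ℝ)..1, k x * ρ x with hS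
  have hRpos : 0 < R := intervalIntegral.integral_pos one_pos hρc
    (fun y hy => (hρ y (Ioc_subset_Icc_self hy)).le) ⟨0, h0, hρ 0 h0⟩
  have hSpos : 0 < S := intervalIntegral.integral_pos one_pos (hkc.mul hρc)
    (fun y hy => (mul_pos (hkpos y hy) (hρ y (Ioc_subset_Icc_self hy))).le)
    ⟨1, h1, mul_pos (hkpos 1 (by simp)) (hρ 1 h1)⟩
  -- m is the ρ-average of k. With `k y = m`, the product `(Q - Q y)(k - m)` is non-negative by
  -- monotonicity, and its weighted integral is S times the difference of the two averages of Q.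
  set m := S / R with hm
  have hmpos : 0 < m := div_pos hSpos hRpos
  have hmR : S = m * R := by rw [hm]; field_simp
  have hmean : ∫ x in (0 : ℝ)..1, (m - k x) * ρ x = 0 := by
    simp only [sub_mul]
    rw [intervalIntegral.integral_sub, intervalIntegral.integral_const_mul]
    · linarith
    · exact hii (continuousOn_const.mul hρc)
    · exact hii (hkc.mul hρc)
  have hk1 : m < k 1 := by
    by_contra! hle
    have := hzero ((continuousOn_const.sub hkc).mul hρc)
      (fun x hx => mul_nonneg (by simp only [Pi.sub_apply]; linarith [hk hx h1 hx.2]) (hρ x hx).le)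
      hmean 0 h0
    have h3 := hρ 0 h0
    simp only [Pi.sub_apply, Pi.mul_apply, hk0, sub_zero] at this
    have := mul_pos hmpos h3
    linarith
  obtain ⟨y, hy, hky⟩ : ∃ y ∈ Icc (0 : ℝ) 1, k y = m :=
    intermediate_value_Icc zero_le_one hkc ⟨by rw [hk0]; exact hmpos.le, hk1.le⟩
  set f : ℝ → ℝ := fun x => (Q x - Q y) * (k x - m) * ρ x with hf
  have hfc : ContinuousOn f (Icc 0 1) :=
    ((hQc.sub continuousOn_const).mul (hkc.sub continuousOn_const)).mul hρc
  have hfn : ∀ x ∈ Icc (0 : ℝ) 1, 0 ≤ f x := by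
    intro x hx
    refine mul_nonneg ?_ (hρ x hx).le
    rw [← hky]
    rcases le_total x y with h | h
    · exact mul_nonneg_of_nonpos_of_nonpos (by linarith [hQ hx hy h]) (by linarith [hk hx hy h])
    · exact mul_nonneg (by linarith [hQ hy hx h]) (by linarith [hk hy hx h])
  have hfi : ∫ x in (0 : ℝ)..1, f x =
      (∫ x in (0 : ℝ)..1, Q x * (k x * ρ x)) - m * ∫ x in (0 : ℝ)..1, Q x * ρ x := by
    have e : f = fun x => (Q x * (k x * ρ x) - m * (Q x * ρ x)) + Q y * ((m - k x) * ρ x) := by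
      funext x
      simp only [hf]
      ring
    rw [e, intervalIntegral.integral_add, intervalIntegral.integral_sub,
      intervalIntegral.integral_const_mul, intervalIntegral.integral_const_mul, hmean]
    · ring
    · exact hii (hQc.mul (hkc.mul hρc))
    · exact hii (continuousOn_const.mul (hQc.mul hρc))
    · exact hii ((hQc.mul (hkc.mul hρc)).sub (continuousOn_const.mul (hQc.mul hρc)))
    · exact hii (continuousOn_const.mul ((continuousOn_const.sub hkc).mul hρc))
  have hdiv : (∫ x in (0 : ℝ)..1, Q x * (k x * ρ x)) / S - (∫ x in (0 : ℝ)..1, Q x * ρ x) / R =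
      (∫ x in (0 : ℝ)..1, f x) / S := by
    rw [hfi, hm]
    field_simp
  constructor
  · have : 0 ≤ (∫ x in (0 : ℝ)..1, f x) / S :=
      div_nonneg (intervalIntegral.integral_nonneg zero_le_one hfn) hSpos.le
    linarith
  · intro heq
    have hfz : ∫ x in (0 : ℝ)..1, f x = 0 := by
      rw [heq, sub_self, eq_comm, div_eq_zero_iff] at hdiv
      exact hdiv.resolve_right hSpos.ne'
    -- In the equality case the integrand vanishes at both endpoints; since `k 0 < m < k 1`, both
    -- endpoint values of Q equal `Q y`.
    have e0 := hzero hfc hfn hfz 0 h0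
    have e1 := hzero hfc hfn hfz 1 h1
    simp only [hf, mul_eq_zero, (hρ 0 h0).ne', (hρ 1 h1).ne', or_false, hk0] at e0 e1
    have q0 : Q 0 - Q y = 0 := e0.resolve_right (by linarith)
    have q1 : Q 1 - Q y = 0 := e1.resolve_right (by linarith)
    linarith

/-- With the opposite order, comparison from 1 would keep z below w, but w is bounded while z blows
up at 0. -/
theorem NeumannRiccati.lt_dirichlet {p q α l₀ l₁ : ℝ} (hpq : p.HolderConjugate q) {V w z : ℝ → ℝ}
    (hw : NeumannRiccati p q α V l₀ w) (hz : DirichletRiccati p q α V l₁ z) : l₀ < l₁ := by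
  by_contra! hle
  obtain ⟨H, hH⟩ := exists_abs_le_of_continuousOn hw.continuousOn
  have hev : ∀ᶠ x in 𝓝[>] (0 : ℝ), H < z x ∧ x ∈ Ioc (0 : ℝ) 1 :=
    (hz.tendsto.eventually (eventually_gt_atTop H)).and (Ioc_mem_nhdsGT one_pos)
  obtain ⟨x, hx, hx1⟩ := hev.exists
  have := Riccati.le_of_right hpq.lt hpq.symm.lt (a := x) (b := 1)
    (fun y hy => hw.riccati y ⟨hx1.1.trans hy.1, hy.2⟩)
    (fun y hy => hz.riccati y ⟨hx1.1.trans hy.1, hy.2⟩)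
    (hw.continuousOn.mono (Icc_subset_Icc_left hx1.1.le))
    (hz.continuousOn.mono fun y hy => ⟨hx1.1.trans_le hy.1, hy.2⟩)
    (fun y _ => by linarith) (by rw [hw.apply_one, hz.apply_one]) x (left_mem_Icc.2 hx1.2)
  linarith [le_abs_self (w x), hH x (Ioc_subset_Icc_self hx1)]

/-- The gap does not decrease when a non-decreasing potential of small oscillation is added. -/
theorem gap_step {p q α l₀ l₁ l₀' l₁' : ℝ} (hpq : p.HolderConjugate q) {V Q w w' z z' : ℝ → ℝ}
    (hV : Continuous V) (hQc : Continuous Q) (hQ : MonotoneOn Q (Icc 0 1))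
    (hw : NeumannRiccati p q α V l₀ w) (hz : DirichletRiccati p q α V l₁ z)
    (hw' : NeumannRiccati p q α (fun x => V x + Q x) l₀' w')
    (hz' : DirichletRiccati p q α (fun x => V x + Q x) l₁' z') (hsmall : Q 1 - Q 0 ≤ l₁ - l₀) :
    l₁ - l₀ ≤ l₁' - l₀' ∧ (l₁ - l₀ = l₁' - l₀' → Q 0 = Q 1) := by
  have hp := hpq.lt
  have h0 : (0 : ℝ) ∈ Icc (0 : ℝ) 1 := by simp
  have h1 : (1 : ℝ) ∈ Icc (0 : ℝ) 1 := by simp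
  have hVQ : Continuous fun x => V x + Q x := hV.add hQc
  obtain ⟨u, hu, hu0⟩ := hw.exists_halfEigen hpq
  obtain ⟨v, hv, hv0⟩ := hz'.exists_halfEigen hpq hVQ
  have hus := hu.halfSobolev hpq
  have hvs := hv.halfSobolev hpq
  have hMu := hu.halfMass_pos hpq
  have hMv := hv.halfMass_pos hpq
  have hupos : ∀ x ∈ Icc (0 : ℝ) 1, 0 < u x := by
    intro x hx
    rcases hx.1.eq_or_lt with rfl | h
    · exact hu0
    · exact hu.pos x ⟨h, hx.2⟩
  -- The old Neumann eigenfunction is a test function for the new problem; in `e2` the new Dirichlet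
  -- eigenfunction is one for the old problem.
  have e1 : l₀' * halfMass p u ≤ l₀ * halfMass p u + ∫ x in (0 : ℝ)..1, Q x * |u x| ^ p := by
    rw [← hu.halfEnergy_eq hpq hV (hu.tendsto_flux_mul_of_neumann hpq hw hu.continuousOn_fun),
      ← hus.halfEnergy_add hp hV hQc]
    exact hw'.mul_halfMass_le hpq hVQ hus
  have e2 : l₁ * halfMass p v + ∫ x in (0 : ℝ)..1, Q x * |v x| ^ p ≤ l₁' * halfMass p v := by
    rw [← hv.halfEnergy_eq hpq hVQ (hv.tendsto_flux_mul_of_apply_zero hv.continuousOn_fun hv0),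
      hvs.halfEnergy_add hp hV hQc]
    gcongr
    exact hz.mul_halfMass_le v _ hvs hv0
  have e1' : l₀' - l₀ ≤ (∫ x in (0 : ℝ)..1, Q x * |u x| ^ p) / halfMass p u := by
    rw [le_div_iff₀ hMu]
    linarith
  have e2' : (∫ x in (0 : ℝ)..1, Q x * |v x| ^ p) / halfMass p v ≤ l₁' - l₁ := by
    rw [div_le_iff₀ hMv]
    linarith
  have e3 : Q 0 ≤ l₁' - l₁ := by
    refine le_trans ?_ e2'
    rw [le_div_iff₀ hMv, halfMass, ← intervalIntegral.integral_const_mul]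
    refine intervalIntegral.integral_mono_on zero_le_one
      ((hvs.intervalIntegrable_rpow hp).const_mul _) (hvs.intervalIntegrable_mul_rpow hp hQc)
      fun x hx => ?_
    have := hQ h0 hx hx.1
    gcongr
  -- The comparison needs `Q ≤ l₁' - l₀`. By monotonicity `Q ≤ Q 1`, and `Q 1 ≤ l₁' - l₀` follows by
  -- adding `e3` to the smallness hypothesis. It yields that v/u is non-decreasing.
  have hcomp : ∀ x ∈ Ioc (0 : ℝ) 1, w x ≤ z' x := by
    intro x hx
    refine Riccati.le_of_right hpq.lt hpq.symm.lt (a := x) (b := 1)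
      (fun y hy => hz'.riccati y ⟨hx.1.trans hy.1, hy.2⟩)
      (fun y hy => hw.riccati y ⟨hx.1.trans hy.1, hy.2⟩)
      (hz'.continuousOn.mono fun y hy => ⟨hx.1.trans_le hy.1, hy.2⟩)
      (hw.continuousOn.mono (Icc_subset_Icc_left hx.1.le))
      (fun y hy => ?_) (by rw [hw.apply_one, hz'.apply_one]) x (left_mem_Icc.2 hx.2)
    have := hQ (a := y) (b := 1) ⟨hx.1.le.trans hy.1.le, hy.2.le⟩ h1 hy.2.le
    linarith
  have hratc : ContinuousOn (fun x => v x / u x) (Icc 0 1) :=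
    hv.continuousOn_fun.div hu.continuousOn_fun fun x hx => (hupos x hx).ne'
  have hrat : MonotoneOn (fun x => v x / u x) (Icc 0 1) := by
    have hder : ∀ x ∈ Ioo (0 : ℝ) 1, HasDerivAt (fun x => v x / u x)
        ((signedPow q (z' x) - signedPow q (w x)) * (v x / u x)) x := by
      intro x hx
      have hux := hupos x (Ioo_subset_Icc_self hx)
      convert! (hv.hasDerivAt x hx).div (hu.hasDerivAt x hx) hux.ne' using 1
      field_simp
    apply monotoneOn_of_deriv_nonneg (convex_Icc _ _) hratc
    · rw [interior_Icc]
      exact fun x hx => (hder x hx).differentiableAt.differentiableWithinAt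
    · rw [interior_Icc]
      intro x hx
      rw [(hder x hx).deriv]
      have hx' := Ioo_subset_Ioc_self hx
      refine mul_nonneg (sub_nonneg.2 (signedPow_mono hpq.symm.lt (hcomp x hx'))) ?_
      exact (div_pos (hv.pos x hx') (hu.pos x hx')).le
  have hvnn : ∀ x ∈ Icc (0 : ℝ) 1, 0 ≤ v x := by
    intro x hx
    rcases hx.1.eq_or_lt with rfl | h
    · exact hv0.ge
    · exact (hv.pos x ⟨h, hx.2⟩).le
  -- With weight `u^p` and `k = (v/u)^p`, the product of k and the weight is `v^p`.
  have hcheb := chebyshev_weighted (Q := Q) (k := fun x => (v x / u x) ^ p)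
    (ρ := fun x => |u x| ^ p) hQ hQc.continuousOn
    (fun x hx y hy hxy => Real.rpow_le_rpow (div_nonneg (hvnn x hx) (hupos x hx).le)
      (hrat hx hy hxy) hpq.nonneg)
    (hratc.rpow_const fun _ _ => Or.inr hpq.nonneg) (hus.continuousOn_rpow hp)
    (fun x hx => Real.rpow_pos_of_pos (abs_pos.2 (hupos x hx).ne') _)
    (by simp [hv0, Real.zero_rpow hpq.ne_zero])
    (fun x hx => Real.rpow_pos_of_pos (div_pos (hv.pos x hx) (hu.pos x hx)) _)
  have hkρ : ∀ x ∈ Icc (0 : ℝ) 1, (v x / u x) ^ p * |u x| ^ p = |v x| ^ p := by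
    intro x hx
    have := hupos x hx
    rw [abs_of_pos this, abs_of_nonneg (hvnn x hx), ← Real.mul_rpow
      (div_nonneg (hvnn x hx) this.le) this.le, div_mul_cancel₀ _ this.ne']
  have i1 : ∫ x in (0 : ℝ)..1, (v x / u x) ^ p * |u x| ^ p = halfMass p v := by
    apply intervalIntegral.integral_congr
    rw [uIcc_of_le zero_le_one]
    exact hkρ
  have i2 : ∫ x in (0 : ℝ)..1, Q x * ((v x / u x) ^ p * |u x| ^ p) =
      ∫ x in (0 : ℝ)..1, Q x * |v x| ^ p := by
    apply intervalIntegral.integral_congr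
    rw [uIcc_of_le zero_le_one]
    intro x hx
    simp only [hkρ x hx]
  simp only [i1, i2] at hcheb
  rw [← halfMass] at hcheb
  refine ⟨by linarith [hcheb.1], fun heq => hcheb.2 (le_antisymm hcheb.1 (by linarith))⟩

/-- The gap of a non-decreasing potential on `[0, 1]` is at least that of the zero potential. -/
theorem exists_gap_le {p q : ℝ} (hpq : p.HolderConjugate q) (α : ℝ) {V : ℝ → ℝ}
    (hV : Continuous V) (hm : MonotoneOn V (Icc 0 1)) :
    ∃ l₀ l₁ l₀' l₁' : ℝ, (∃ w, NeumannRiccati p q α (fun _ => 0) l₀ w) ∧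
      (∃ w, DirichletRiccati p q α (fun _ => 0) l₁ w) ∧
      (∃ w, NeumannRiccati p q α V l₀' w) ∧ (∃ w, DirichletRiccati p q α V l₁' w) ∧
      l₁ - l₀ ≤ l₁' - l₀' ∧ (l₁ - l₀ = l₁' - l₀' → V 0 = V 1) := by
  have h0 : (0 : ℝ) ∈ Icc (0 : ℝ) 1 := by simp
  have h1 : (1 : ℝ) ∈ Icc (0 : ℝ) 1 := by simp
  have hVt : ∀ t : ℝ, Continuous fun x => t * V x := fun t => continuous_const.mul hV
  choose l₀ w hw using fun t : ℝ => exists_neumannRiccati hpq α (hVt t)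
  choose l₁ z hz using fun t : ℝ => exists_dirichletRiccati hpq α (hVt t)
  have hg0 : 0 < l₁ 0 - l₀ 0 := sub_pos.2 ((hw 0).lt_dirichlet hpq (hz 0))
  have hosc : 0 ≤ V 1 - V 0 := sub_nonneg.2 (hm h0 h1 zero_le_one)
  -- N makes the oscillation of V/N at most the gap of the zero potential.
  obtain ⟨N, hN⟩ := exists_nat_gt ((V 1 - V 0) / (l₁ 0 - l₀ 0))
  have hNpos : (0 : ℝ) < N := (div_nonneg hosc hg0.le).trans_lt hN
  have hN' : (1 / N : ℝ) * (V 1 - V 0) ≤ l₁ 0 - l₀ 0 := by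
    rw [div_lt_iff₀ hg0] at hN
    rw [div_mul_eq_mul_div, one_mul, div_le_iff₀ hNpos]
    linarith
  have hstep : ∀ t : ℝ, l₁ 0 - l₀ 0 ≤ l₁ t - l₀ t →
      l₁ t - l₀ t ≤ l₁ (t + 1 / N) - l₀ (t + 1 / N) ∧
      (l₁ t - l₀ t = l₁ (t + 1 / N) - l₀ (t + 1 / N) → V 0 = V 1) := by
    intro t ht
    have hadd : (fun x => (t + 1 / N) * V x) = fun x => t * V x + 1 / N * V x := by
      funext x
      ring
    have hw' := hw (t + 1 / N)
    have hz' := hz (t + 1 / N)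
    rw [hadd] at hw' hz'
    have key := gap_step hpq (hVt t) (hVt (1 / N))
      (fun x hx y hy hxy => mul_le_mul_of_nonneg_left (hm hx hy hxy) (by positivity))
      (hw t) (hz t) hw' hz' (by linarith)
    refine ⟨key.1, fun h => ?_⟩
    exact mul_left_cancel₀ (by positivity) (key.2 h)
  have hind : ∀ k : ℕ, l₁ 0 - l₀ 0 ≤ l₁ (k / N) - l₀ (k / N) := by
    intro k
    induction k with
    | zero => simp
    | succ k ih =>
      have := (hstep (k / N) ih).1
      rw [← add_div] at this
      push_cast
      exact ih.trans this
  refine ⟨l₀ 0, l₁ 0, l₀ 1, l₁ 1, ⟨w 0, by simpa using hw 0⟩, ⟨z 0, by simpa using hz 0⟩,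
    ⟨w 1, by simpa using hw 1⟩, ⟨z 1, by simpa using hz 1⟩, ?_, fun heq => ?_⟩
  · simpa [hNpos.ne'] using hind N
  · have hNpos' : 1 ≤ N := Nat.one_le_iff_ne_zero.2 (by rintro rfl; simp at hNpos)
    -- Equality of the total gaps forces equality in the last step, from (N - 1)/N to 1, and its
    -- equality case suffices.
    have hs := hstep ((N - 1 : ℕ) / N) (hind _)
    have : ((N - 1 : ℕ) / N + 1 / N : ℝ) = 1 := by
      rw [← add_div, Nat.cast_sub hNpos']
      simp [hNpos.ne']
    rw [this] at hs
    exact hs.2 (le_antisymm hs.1 (by linarith [hind (N - 1)]))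

/-! ### The Sobolev space `W^{1,p}(I)` -/

theorem integral_volI (f : ℝ → ℝ) : ∫ x, f x ∂volI = ∫ x in (-1 : ℝ)..1, f x := by
  rw [intervalIntegral.integral_of_le (by norm_num), integral_Ioc_eq_integral_Ioo]

theorem intervalIntegrable_iff_volI {f : ℝ → ℝ} :
    IntervalIntegrable f volume (-1) 1 ↔ Integrable f volI :=
  intervalIntegrable_iff_integrableOn_Ioo_of_le (by norm_num)

theorem exists_zero_of_le_abs {φ : ℝ → ℝ} (hs : HasCompactSupport φ)
    (ht : tsupport φ ⊆ Ioo (-1 : ℝ) 1) : ∃ r, 0 < r ∧ r < 1 ∧ ∀ x, r ≤ |x| → φ x = 0 := by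
  rcases (tsupport φ).eq_empty_or_nonempty with h | h
  · exact ⟨1 / 2, by norm_num, by norm_num, fun x _ =>
      image_eq_zero_of_notMem_tsupport (by simp [h])⟩
  · obtain ⟨y, hy, hmax⟩ := hs.isCompact.exists_isMaxOn h continuous_abs.continuousOn
    have hy1 : |y| < 1 := abs_lt.2 (ht hy)
    refine ⟨(|y| + 1) / 2, by positivity, by linarith, fun x hx => ?_⟩
    apply image_eq_zero_of_notMem_tsupport
    intro hmem
    have : |x| ≤ |y| := hmax hmem
    linarith

theorem integral_mul_deriv_primitive {g φ : ℝ → ℝ} (hg : IntervalIntegrable g volume (-1) 1) (c : ℝ)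
    (hφ : ContDiff ℝ ∞ φ) (hs : HasCompactSupport φ) (ht : tsupport φ ⊆ Ioo (-1 : ℝ) 1) :
    ∫ x in (-1 : ℝ)..1, (c + ∫ t in (0 : ℝ)..x, g t) * deriv φ x =
      -∫ x in (-1 : ℝ)..1, g x * φ x := by
  obtain ⟨r, hr0, hr1, hr⟩ := exists_zero_of_le_abs hs ht
  have hFac : AbsolutelyContinuousOnInterval (fun x => c + ∫ t in (0 : ℝ)..x, g t) (-1) 1 :=
    (LipschitzWith.const c).lipschitzOnWith.absolutelyContinuousOnInterval.add
      (hg.absolutelyContinuousOnInterval_intervalIntegral (by simp))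
  have hφac : AbsolutelyContinuousOnInterval φ (-1) 1 :=
    (hφ.of_le (by simp)).contDiffOn.absolutelyContinuousOnInterval
  rw [hFac.integral_mul_deriv_eq_deriv_mul hφac, hr 1 (by simp [hr1.le]),
    hr (-1) (by simp [hr1.le])]
  simp only [mul_zero, sub_zero, zero_sub, neg_inj]
  apply intervalIntegral.integral_congr_ae
  filter_upwards [hg.ae_hasDerivAt_integral] with x hx hx'
  rw [((hx (uIoc_subset_uIcc hx') 0 (by simp)).const_add c).deriv]

/-- The du Bois-Reymond lemma on `(-1, 1)`. -/
theorem eq_const_of_integral_mul_deriv_eq_zero {h : ℝ → ℝ} (hc : ContinuousOn h (Icc (-1) 1))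
    (H : ∀ φ : ℝ → ℝ, ContDiff ℝ ∞ φ → HasCompactSupport φ → tsupport φ ⊆ Ioo (-1 : ℝ) 1 →
      ∫ x in (-1 : ℝ)..1, h x * deriv φ x = 0) :
    ∃ c, ∀ x ∈ Icc (-1 : ℝ) 1, h x = c := by
  have hle : (-1 : ℝ) ≤ 1 := by norm_num
  let b : ContDiffBump (0 : ℝ) := ⟨1 / 4, 1 / 2, by norm_num, by norm_num⟩
  have hbz : ∀ x, 1 / 2 ≤ |x| → b x = 0 := fun x hx =>
    b.zero_of_le_dist (by rw [Real.dist_eq, sub_zero]; exact hx)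
  have hb0 : b 0 = 1 := b.one_of_mem_closedBall (by simp [b.rIn_pos.le])
  set I := ∫ x in (-1 : ℝ)..1, b x
  have hI : 0 < I := intervalIntegral.integral_pos (by norm_num) b.continuous.continuousOn
    (fun x _ => b.nonneg) ⟨0, by simp, by rw [hb0]; exact one_pos⟩
  have hii : ∀ {f : ℝ → ℝ}, ContinuousOn f (Icc (-1) 1) → IntervalIntegrable f volume (-1) 1 := by
    intro f hf
    apply ContinuousOn.intervalIntegrable
    rwa [uIcc_of_le hle]
  set κ := (∫ x in (-1 : ℝ)..1, h x * b x) / I with hκ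
  have key : ∀ φ : ℝ → ℝ, ContDiff ℝ ∞ φ → HasCompactSupport φ → tsupport φ ⊆ Ioo (-1 : ℝ) 1 →
      ∫ x, φ x • (h x - κ) ∂volI = 0 := by
    intro φ hφ hs ht
    obtain ⟨r', hr0', hr1', hr'⟩ := exists_zero_of_le_abs hs ht
    set r := max r' (1 / 2) with hrdef
    have hr0 : 0 < r := lt_max_of_lt_left hr0'
    have hr1 : r < 1 := max_lt hr1' (by norm_num)
    -- Subtracting m times the bump gives F integral zero, so its primitive Φ vanishes near both
    -- endpoints and is an admissible test function.
    set m := (∫ x in (-1 : ℝ)..1, φ x) / I with hm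
    set F : ℝ → ℝ := fun x => φ x - m * b x with hF
    have hFz : ∀ x, r ≤ |x| → F x = 0 := fun x hx => by
      simp only [hF]
      rw [hr' x ((le_max_left _ _).trans hx), hbz x ((le_max_right _ _).trans hx)]
      ring
    have hFs : ContDiff ℝ ∞ F := hφ.sub (contDiff_const.mul b.contDiff)
    have hFc : Continuous F := hFs.continuous
    set Φ : ℝ → ℝ := fun x => ∫ t in (-1 : ℝ)..x, F t with hΦ
    have hΦd : ∀ x, HasDerivAt Φ (F x) x := fun x => hFc.integral_hasStrictDerivAt _ _ |>.hasDerivAt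
    have hΦderiv : deriv Φ = F := funext fun x => (hΦd x).deriv
    have hΦs : ContDiff ℝ ∞ Φ := by
      rw [contDiff_infty_iff_deriv, hΦderiv]
      exact ⟨fun x => (hΦd x).differentiableAt, hFs⟩
    have hΦ1 : Φ 1 = 0 := by
      simp only [hΦ, hF]
      rw [intervalIntegral.integral_sub, intervalIntegral.integral_const_mul, hm]
      · change _ - _ / I * I = 0
        rw [div_mul_cancel₀ _ hI.ne', sub_self]
      · exact hφ.continuous.intervalIntegrable _ _
      · exact (continuous_const.mul b.continuous).intervalIntegrable _ _
    have hzero : ∀ s x : ℝ, (∀ t ∈ uIoc s x, r ≤ |t|) → ∫ t in s..x, F t = 0 := by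
      intro s x hsx
      rw [intervalIntegral.integral_congr_ae (g := fun _ => 0)
        (Eventually.of_forall fun t ht => hFz t (hsx t ht))]
      simp
    have hΦz : ∀ x, x ∉ Icc (-r) r → Φ x = 0 := by
      intro x hx
      rcases lt_or_ge x (-r) with h' | h'
      · refine hzero _ _ fun t ht => ?_
        have : t ≤ -r := ht.2.trans (max_le (by linarith) h'.le)
        rw [abs_of_nonpos (by linarith)]
        linarith
      · have hxr : r < x := by
          by_contra! hcon
          exact hx ⟨h', hcon⟩
        have e : Φ x = Φ 1 + ∫ t in (1 : ℝ)..x, F t :=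
          (intervalIntegral.integral_add_adjacent_intervals (hFc.intervalIntegrable _ _)
            (hFc.intervalIntegrable _ _)).symm
        rw [e, hΦ1, zero_add]
        refine hzero _ _ fun t ht => ?_
        have : r ≤ t := (le_min hr1.le hxr.le).trans ht.1.le
        exact this.trans (le_abs_self t)
    have hΦt : tsupport Φ ⊆ Icc (-r) r := by
      refine closure_minimal (fun x hx => ?_) isClosed_Icc
      by_contra hcon
      exact hx (hΦz x hcon)
    have e := H Φ hΦs (HasCompactSupport.intro isCompact_Icc hΦz)
      (hΦt.trans fun x hx => ⟨by linarith [hx.1], by linarith [hx.2]⟩)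
    rw [hΦderiv] at e
    have e2 : (fun x => h x * F x) = fun x => h x * φ x - m * (h x * b x) := by
      funext x
      simp only [hF]
      ring
    rw [e2, intervalIntegral.integral_sub, intervalIntegral.integral_const_mul] at e
    · rw [integral_volI]
      have e3 : (fun x => φ x • (h x - κ)) = fun x => h x * φ x - κ * φ x := by
        funext x
        simp only [smul_eq_mul]
        ring
      rw [e3, intervalIntegral.integral_sub, intervalIntegral.integral_const_mul]
      · rw [hκ]
        rw [hm] at e
        refine Eq.trans ?_ e
        ring
      · exact hii (hc.mul hφ.continuous.continuousOn)
      · exact hii (continuousOn_const.mul hφ.continuous.continuousOn)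
    · exact hii (hc.mul hφ.continuous.continuousOn)
    · exact hii (continuousOn_const.mul (hc.mul b.continuous.continuousOn))
  have hint : Integrable (fun x => h x - κ) volI :=
    intervalIntegrable_iff_volI.1 (hii (hc.sub continuousOn_const))
  have hae := isOpen_Ioo.ae_eq_zero_of_integral_contDiff_smul_eq_zero
    (hint.locallyIntegrable.locallyIntegrableOn (Ioo (-1 : ℝ) 1)) key
  refine ⟨κ, Measure.eqOn_Icc_of_ae_eq volume (by norm_num : (-1 : ℝ) ≠ 1) ?_ hc
    continuousOn_const⟩
  rw [← Measure.restrict_congr_set (Ioo_ae_eq_Icc (a := (-1 : ℝ)) (b := 1) (μ := volume))]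
  rw [ae_restrict_iff' measurableSet_Ioo] at hae
  rw [EventuallyEq, ae_restrict_iff' measurableSet_Ioo]
  filter_upwards [hae] with x hx hx'
  linarith [hx hx' hx']

section

variable {p : ℝ} [hp : Fact (1 < p)]

theorem memLp_der (w : W1p p) : MemLp (der w) (ENNReal.ofReal p) volI := Lp.memLp w.1.2

theorem integrable_der (w : W1p p) : Integrable (der w) volI :=
  (memLp_der w).integrable Fact.out

theorem integrable_abs_rpow_of_memLp {g : ℝ → ℝ} (hg : MemLp g (ENNReal.ofReal p) volI) :
    Integrable (fun x => |g x| ^ p) volI := by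
  have := hg.integrable_norm_rpow (by simp [hp.out.le.trans_lt' one_pos]) (by simp)
  simpa [ENNReal.toReal_ofReal (by linarith [hp.out] : (0 : ℝ) ≤ p)] using this

theorem continuous_fn (w : W1p p) : Continuous (fn w) := w.1.1.continuous.Icc_extend'

/-- The continuous representative minus the primitive of the weak derivative has zero weak
derivative, so it is constant by the du Bois-Reymond lemma. -/
theorem fn_eq_integral (w : W1p p) :
    ∀ x ∈ Icc (-1 : ℝ) 1, fn w x = fn w 0 + ∫ t in (0 : ℝ)..x, der w t := by
  have hg := intervalIntegrable_iff_volI.2 (integrable_der w)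
  have hGc : ContinuousOn (fun x => ∫ t in (0 : ℝ)..x, der w t) (Icc (-1) 1) := by
    have := (hg.absolutelyContinuousOnInterval_intervalIntegral (c := 0) (by simp)).continuousOn
    rwa [uIcc_of_le (by norm_num)] at this
  obtain ⟨c, hc⟩ := eq_const_of_integral_mul_deriv_eq_zero
    (h := fun x => fn w x - ∫ t in (0 : ℝ)..x, der w t)
    ((continuous_fn w).continuousOn.sub hGc) fun φ h1 h2 h3 => by
      have e1 := w.2 φ h1 h2 h3
      rw [integral_volI, integral_volI] at e1
      have e2 := integral_mul_deriv_primitive hg 0 h1 h2 h3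
      simp only [zero_add] at e2
      have hd : Continuous (deriv φ) := h1.continuous_deriv (by simp)
      simp only [sub_mul]
      rw [intervalIntegral.integral_sub, e2]
      · change (∫ x in (-1 : ℝ)..1, ext w.1.1 x * deriv φ x) -
          -(∫ x in (-1 : ℝ)..1, w.1.2 x * φ x) = 0
        rw [e1]
        ring
      · exact ((continuous_fn w).mul hd).intervalIntegrable _ _
      · apply ContinuousOn.intervalIntegrable
        rw [uIcc_of_le (by norm_num)]
        exact hGc.mul hd.continuousOn
  intro x hx
  have h0 := hc 0 (by simp)
  have hx' := hc x hx
  simp only [intervalIntegral.integral_same, sub_zero] at h0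
  linarith

theorem exists_W1p {g : ℝ → ℝ} (hg : MemLp g (ENNReal.ofReal p) volI) (c : ℝ) :
    ∃ w : W1p p, (∀ x ∈ Icc (-1 : ℝ) 1, fn w x = c + ∫ t in (0 : ℝ)..x, g t) ∧
      der w =ᵐ[volI] g := by
  have hgi := intervalIntegrable_iff_volI.2 (hg.integrable Fact.out)
  have hGc : ContinuousOn (fun x => c + ∫ t in (0 : ℝ)..x, g t) (Icc (-1) 1) := by
    have := (hgi.absolutelyContinuousOnInterval_intervalIntegral (c := 0) (by simp)).continuousOn
    rw [uIcc_of_le (by norm_num)] at this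
    exact continuousOn_const.add this
  let u : C(Icc (-1 : ℝ) 1, ℝ) := ⟨fun x => c + ∫ t in (0 : ℝ)..x, g t, hGc.domRestrict⟩
  have hu : ∀ x ∈ Icc (-1 : ℝ) 1, ext u x = c + ∫ t in (0 : ℝ)..x, g t := fun x hx => by
    rw [ext, IccExtend_of_mem _ _ hx]
    rfl
  refine ⟨⟨(u, hg.toLp g), fun φ h1 h2 h3 => ?_⟩, hu, hg.coeFn_toLp⟩
  have e := integral_mul_deriv_primitive hgi c h1 h2 h3
  have e1 : ∫ x, (hg.toLp g) x * φ x ∂volI = ∫ x, g x * φ x ∂volI := by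
    apply integral_congr_ae
    filter_upwards [hg.coeFn_toLp] with x hx
    rw [hx]
  have e2 : ∫ x, ext u x * deriv φ x ∂volI = ∫ x in (-1 : ℝ)..1,
      (c + ∫ t in (0 : ℝ)..x, g t) * deriv φ x := by
    rw [integral_volI]
    apply intervalIntegral.integral_congr
    rw [uIcc_of_le (by norm_num)]
    intro x hx
    simp only [hu x hx]
  change ∫ x, ext u x * deriv φ x ∂volI = -∫ x, (hg.toLp g) x * φ x ∂volI
  rw [e1, e2, e, integral_volI]

theorem W1p_eq_zero_of_fn_eq_zero (w : W1p p) (h : ∀ x ∈ Icc (-1 : ℝ) 1, fn w x = 0) : w = 0 := by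
  have hd : ∀ᵐ x ∂volI, x ∈ Ioo (-1 : ℝ) 1 → der w x = 0 := by
    refine isOpen_Ioo.ae_eq_zero_of_integral_contDiff_smul_eq_zero
      ((integrable_der w).locallyIntegrable.locallyIntegrableOn _) fun φ h1 h2 h3 => ?_
    have e := w.2 φ h1 h2 h3
    have e1 : ∫ x, ext w.1.1 x * deriv φ x ∂volI = 0 := by
      rw [integral_volI, intervalIntegral.integral_congr (g := fun _ => 0)]
      · simp
      · rw [uIcc_of_le (by norm_num)]
        intro x hx
        have := h x hx
        simp only [fn] at this
        simp [this]
    rw [e1] at e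
    simp only [smul_eq_mul]
    rw [← neg_eq_zero, e]
    congr 1
    apply integral_congr_ae
    exact Eventually.of_forall fun x => mul_comm _ _
  apply Subtype.ext
  apply Prod.ext
  · ext x
    have := h x x.2
    rw [fn, ext, IccExtend_of_mem _ _ x.2] at this
    exact this
  · apply Lp.ext
    rw [ae_restrict_iff' measurableSet_Ioo] at hd
    have h0 := Lp.coeFn_zero ℝ (ENNReal.ofReal p) volI
    rw [EventuallyEq, ae_restrict_iff' measurableSet_Ioo] at h0 ⊢
    filter_upwards [hd, h0] with x hx hx0 hmem
    rw [show ((0 : W1p p) : C(Icc (-1 : ℝ) 1, ℝ) × Lp ℝ (ENNReal.ofReal p) volI).2 = 0 from rfl,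
      hx0 hmem]
    exact hx hmem hmem

end

/-! ### Splitting Sobolev functions on `I` into two halves -/

theorem intervalIntegrable_comp_neg {F : ℝ → ℝ}
    (h : IntervalIntegrable (fun x => F (-x)) volume 0 1) : IntervalIntegrable F volume (-1) 0 := by
  have := (IntervalIntegrable.iff_comp_neg (f := fun x => F (-x))).1 h
  simpa using this.symm

theorem integral_volI_eq_halves {F : ℝ → ℝ} (h₁ : IntervalIntegrable F volume 0 1)
    (h₂ : IntervalIntegrable (fun x => F (-x)) volume 0 1) :
    ∫ x, F x ∂volI = (∫ x in (0 : ℝ)..1, F x) + ∫ x in (0 : ℝ)..1, F (-x) := by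
  rw [integral_volI, ← intervalIntegral.integral_add_adjacent_intervals
    (intervalIntegrable_comp_neg h₂) h₁, intervalIntegral.integral_comp_neg]
  simp [add_comm]

theorem ae_comp_neg {P : ℝ → Prop} (h : ∀ᵐ x : ℝ, P x) : ∀ᵐ x : ℝ, P (-x) :=
  (Measure.measurePreserving_neg (volume : Measure ℝ)).quasiMeasurePreserving.ae h

theorem intervalIntegrable_congr_Ioc {f g : ℝ → ℝ} (h : ∀ᵐ x : ℝ, x ∈ Ioc (0 : ℝ) 1 → f x = g x)
    (hg : IntervalIntegrable g volume 0 1) : IntervalIntegrable f volume 0 1 := by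
  refine hg.congr_ae ?_
  rw [uIoc_of_le zero_le_one, EventuallyEq, ae_restrict_iff' measurableSet_Ioc]
  filter_upwards [h] with x hx hx'
  exact (hx hx').symm

theorem integral_congr_Ioc {f g : ℝ → ℝ} (h : ∀ᵐ x : ℝ, x ∈ Ioc (0 : ℝ) 1 → f x = g x) :
    ∫ x in (0 : ℝ)..1, f x = ∫ x in (0 : ℝ)..1, g x := by
  apply intervalIntegral.integral_congr_ae
  rwa [uIoc_of_le zero_le_one]

theorem HalfSobolev.const_mul {p a : ℝ} {f g : ℝ → ℝ} (h : HalfSobolev p f g) :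
    HalfSobolev p (fun x => a * f x) (fun x => a * g x) := by
  refine ⟨h.integrable.const_mul a, ?_, fun x hx => ?_⟩
  · simp only [abs_mul, Real.mul_rpow (abs_nonneg _) (abs_nonneg _)]
    exact h.integrable_rpow.const_mul _
  · rw [intervalIntegral.integral_const_mul, h.eq_integral x hx]
    ring

theorem HalfSobolev.zero {p : ℝ} : HalfSobolev p (fun _ => 0) (fun _ => 0) :=
  ⟨by simp, by simp, by simp⟩

theorem halfEnergy_const_mul {p α a : ℝ} {U f g : ℝ → ℝ} :
    halfEnergy p α U (fun x => a * f x) (fun x => a * g x) = |a| ^ p * halfEnergy p α U f g := by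
  simp only [halfEnergy, abs_mul, Real.mul_rpow (abs_nonneg a) (abs_nonneg _)]
  rw [mul_add, ← intervalIntegral.integral_const_mul]
  congr 1
  · congr 1
    funext x
    ring
  · ring

theorem halfMass_const_mul {p a : ℝ} {f : ℝ → ℝ} :
    halfMass p (fun x => a * f x) = |a| ^ p * halfMass p f := by
  simp only [halfMass, abs_mul, Real.mul_rpow (abs_nonneg a) (abs_nonneg _)]
  rw [intervalIntegral.integral_const_mul]

section

variable {p : ℝ} [hp : Fact (1 < p)]

/-- The restrictions of `W` to `[0, 1]` and of its reflection to `[0, 1]` are `f₁` and `f₂`, with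
derivatives `g₁` and `g₂`. -/
structure Halves (W : W1p p) (f₁ g₁ f₂ g₂ : ℝ → ℝ) : Prop where
  right : ∀ x ∈ Icc (0 : ℝ) 1, fn W x = f₁ x
  left : ∀ x ∈ Icc (0 : ℝ) 1, fn W (-x) = f₂ x
  der_right : ∀ᵐ x : ℝ, x ∈ Ioc (0 : ℝ) 1 → der W x = g₁ x
  der_left : ∀ᵐ x : ℝ, x ∈ Ioc (0 : ℝ) 1 → der W (-x) = -g₂ x
  sobolev_right : HalfSobolev p f₁ g₁
  sobolev_left : HalfSobolev p f₂ g₂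

theorem halves_self (W : W1p p) :
    Halves W (fn W) (der W) (fun x => fn W (-x)) (fun x => -der W (-x)) := by
  have h1 := intervalIntegrable_iff_volI.2 (integrable_der W)
  have h2 := intervalIntegrable_iff_volI.2 (integrable_abs_rpow_of_memLp (memLp_der W))
  have hr : uIcc (0 : ℝ) 1 ⊆ uIcc (-1) 1 := by
    rw [uIcc_of_le zero_le_one, uIcc_of_le (by norm_num)]
    exact Icc_subset_Icc_left (by norm_num)
  have hl : uIcc (0 : ℝ) (-1) ⊆ uIcc (-1) 1 := by
    rw [uIcc_of_ge (by norm_num), uIcc_of_le (by norm_num)]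
    exact Icc_subset_Icc_right (by norm_num)
  have hneg : ∀ {F : ℝ → ℝ}, IntervalIntegrable F volume (-1) 1 →
      IntervalIntegrable (fun x => F (-x)) volume 0 1 := fun hF => by
    have := (IntervalIntegrable.iff_comp_neg (f := _)).1 (hF.mono_set hl)
    simpa using this
  refine ⟨fun _ _ => rfl, fun _ _ => rfl, by simp, by simp,
    ⟨h1.mono_set hr, h2.mono_set hr, fun x hx => fn_eq_integral W x ⟨by linarith [hx.1], hx.2⟩⟩,
    ⟨(hneg h1).neg, by simpa using hneg h2, fun x hx => ?_⟩⟩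
  have := fn_eq_integral W (-x) ⟨by linarith [hx.2], by linarith [hx.1]⟩
  rw [this, neg_zero, intervalIntegral.integral_neg, intervalIntegral.integral_comp_neg,
    ← intervalIntegral.integral_symm]
  simp

theorem fn_add (W W' : W1p p) (x : ℝ) : fn (W + W') x = fn W x + fn W' x := by
  simp [fn, IccExtend]

theorem fn_smul (a : ℝ) (W : W1p p) (x : ℝ) : fn (a • W) x = a * fn W x := by
  simp [fn, IccExtend]

theorem ae_of_ae_volI {P : ℝ → Prop} (h : ∀ᵐ x ∂volI, P x) :
    (∀ᵐ x : ℝ, x ∈ Ioc (0 : ℝ) 1 → P x) ∧ ∀ᵐ x : ℝ, x ∈ Ioc (0 : ℝ) 1 → P (-x) := by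
  rw [ae_restrict_iff' measurableSet_Ioo] at h
  have h1 : ∀ᵐ x : ℝ, x ≠ 1 := by simp [ae_iff]
  constructor
  · filter_upwards [h, h1] with x hx hx1 hm
    exact hx ⟨by linarith [hm.1], lt_of_le_of_ne hm.2 hx1⟩
  · filter_upwards [ae_comp_neg h, h1] with x hx hx1 hm
    exact hx ⟨neg_lt_neg (lt_of_le_of_ne hm.2 hx1), by linarith [hm.1]⟩

theorem Halves.smul {W : W1p p} {f₁ g₁ f₂ g₂ : ℝ → ℝ} (h : Halves W f₁ g₁ f₂ g₂) (a : ℝ) :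
    Halves (a • W) (fun x => a * f₁ x) (fun x => a * g₁ x) (fun x => a * f₂ x)
      (fun x => a * g₂ x) := by
  have hd : ∀ᵐ x ∂volI, der (a • W) x = a * der W x := by
    filter_upwards [Lp.coeFn_smul a W.1.2] with x hx
    simpa [der] using hx
  obtain ⟨h1, h2⟩ := ae_of_ae_volI hd
  refine ⟨fun x hx => by rw [fn_smul, h.right x hx], fun x hx => by rw [fn_smul, h.left x hx],
    ?_, ?_, h.sobolev_right.const_mul, h.sobolev_left.const_mul⟩
  · filter_upwards [h1, h.der_right] with x hx hx' hm
    rw [hx hm, hx' hm]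
  · filter_upwards [h2, h.der_left] with x hx hx' hm
    rw [hx hm, hx' hm]
    ring

/-- Equal values at 0 are all that gluing requires: the concatenated derivative, with the sign
changed on the reflected half, has a primitive matching both pieces. -/
theorem exists_halves {f₁ g₁ f₂ g₂ : ℝ → ℝ} (h₁ : HalfSobolev p f₁ g₁)
    (h₂ : HalfSobolev p f₂ g₂) (h0 : f₁ 0 = f₂ 0) : ∃ W : W1p p, Halves W f₁ g₁ f₂ g₂ := by
  set G : ℝ → ℝ := fun x => if 0 < x then g₁ x else -g₂ (-x) with hG
  have hGr : ∀ x ∈ Ioc (0 : ℝ) 1, G x = g₁ x := fun x hx => by simp [hG, hx.1]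
  have hGl : ∀ x ∈ Ioc (0 : ℝ) 1, G (-x) = -g₂ x := fun x hx => by simp [hG, hx.1.le]
  have i1 : IntervalIntegrable G volume 0 1 :=
    intervalIntegrable_congr_Ioc (Eventually.of_forall hGr) h₁.integrable
  have i2 : IntervalIntegrable (fun x => G (-x)) volume 0 1 :=
    intervalIntegrable_congr_Ioc (Eventually.of_forall hGl) h₂.integrable.neg
  have i3 : IntervalIntegrable (fun x => |G x| ^ p) volume 0 1 :=
    intervalIntegrable_congr_Ioc (Eventually.of_forall fun x hx => by rw [hGr x hx])
      h₁.integrable_rpow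
  have i4 : IntervalIntegrable (fun x => |G (-x)| ^ p) volume 0 1 :=
    intervalIntegrable_congr_Ioc (Eventually.of_forall fun x hx => by rw [hGl x hx, abs_neg])
      h₂.integrable_rpow
  have hGi := intervalIntegrable_iff_volI.1 ((intervalIntegrable_comp_neg i2).trans i1)
  have hGp := intervalIntegrable_iff_volI.1
    ((intervalIntegrable_comp_neg (F := fun x => |G x| ^ p) i4).trans i3)
  have hp0 : (0 : ℝ) ≤ p := by linarith [hp.out]
  have hmem : MemLp G (ENNReal.ofReal p) volI := by
    rw [← integrable_norm_rpow_iff hGi.aestronglyMeasurable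
      (by simp [hp.out.le.trans_lt' one_pos]) (by simp)]
    simpa [ENNReal.toReal_ofReal hp0] using hGp
  obtain ⟨W, hW, hd⟩ := exists_W1p hmem (f₁ 0)
  obtain ⟨d1, d2⟩ := ae_of_ae_volI hd
  refine ⟨W, ⟨fun x hx => ?_, fun x hx => ?_, ?_, ?_, h₁, h₂⟩⟩
  · rw [hW x ⟨by linarith [hx.1], hx.2⟩, h₁.eq_integral x hx]
    congr 1
    apply intervalIntegral.integral_congr_ae
    rw [uIoc_of_le hx.1]
    exact Eventually.of_forall fun t ht => hGr t ⟨ht.1, ht.2.trans hx.2⟩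
  · rw [hW (-x) ⟨by linarith [hx.2], by linarith [hx.1]⟩, h₂.eq_integral x hx, h0]
    congr 1
    have e : ∫ t in (0 : ℝ)..(-x), G t = -∫ t in (0 : ℝ)..x, G (-t) := by
      rw [intervalIntegral.integral_comp_neg, neg_zero, ← intervalIntegral.integral_symm]
    rw [e, ← intervalIntegral.integral_neg]
    apply intervalIntegral.integral_congr_ae
    rw [uIoc_of_le hx.1]
    exact Eventually.of_forall fun t ht => by rw [hGl t ⟨ht.1, ht.2.trans hx.2⟩, neg_neg]
  · filter_upwards [d1] with x hx hm
    rw [hx hm, hGr x hm]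
  · filter_upwards [d2] with x hx hm
    rw [hx hm, hGl x hm]

/-- `V` is, on `[-1, 1]`, the even extension of the restriction of `U` to `[0, 1]`. -/
def IsEvenExtension (V U : ℝ → ℝ) : Prop := ∀ x ∈ Icc (0 : ℝ) 1, V x = U x ∧ V (-x) = U x

theorem Halves.mass {W : W1p p} {f₁ g₁ f₂ g₂ : ℝ → ℝ} (h : Halves W f₁ g₁ f₂ g₂) :
    ∫ x, |fn W x| ^ p ∂volI = halfMass p f₁ + halfMass p f₂ := by
  have c1 : ∀ᵐ x : ℝ, x ∈ Ioc (0 : ℝ) 1 → |fn W x| ^ p = |f₁ x| ^ p :=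
    Eventually.of_forall fun x hx => by rw [h.right x (Ioc_subset_Icc_self hx)]
  have c2 : ∀ᵐ x : ℝ, x ∈ Ioc (0 : ℝ) 1 → |fn W (-x)| ^ p = |f₂ x| ^ p :=
    Eventually.of_forall fun x hx => by rw [h.left x (Ioc_subset_Icc_self hx)]
  rw [integral_volI_eq_halves
    (intervalIntegrable_congr_Ioc c1 (h.sobolev_right.intervalIntegrable_rpow hp.out))
    (intervalIntegrable_congr_Ioc c2 (h.sobolev_left.intervalIntegrable_rpow hp.out)),
    integral_congr_Ioc c1, integral_congr_Ioc c2, halfMass, halfMass]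

theorem Halves.energy {W : W1p p} {f₁ g₁ f₂ g₂ U V : ℝ → ℝ} {α : ℝ} (h : Halves W f₁ g₁ f₂ g₂)
    (hU : Continuous U) (hV : IsEvenExtension V U) :
    (∫ x, |der W x| ^ p + V x * |fn W x| ^ p ∂volI) + α * (|fn W 1| ^ p + |fn W (-1)| ^ p) =
      halfEnergy p α U f₁ g₁ + halfEnergy p α U f₂ g₂ := by
  have c1 : ∀ᵐ x : ℝ, x ∈ Ioc (0 : ℝ) 1 → |der W x| ^ p + V x * |fn W x| ^ p =
      |g₁ x| ^ p + U x * |f₁ x| ^ p := by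
    filter_upwards [h.der_right] with x hx hm
    rw [hx hm, h.right x (Ioc_subset_Icc_self hm), (hV x (Ioc_subset_Icc_self hm)).1]
  have c2 : ∀ᵐ x : ℝ, x ∈ Ioc (0 : ℝ) 1 → |der W (-x)| ^ p + V (-x) * |fn W (-x)| ^ p =
      |g₂ x| ^ p + U x * |f₂ x| ^ p := by
    filter_upwards [h.der_left] with x hx hm
    rw [hx hm, h.left x (Ioc_subset_Icc_self hm), (hV x (Ioc_subset_Icc_self hm)).2, abs_neg]
  have b1 : fn W 1 = f₁ 1 := h.right 1 (by simp)
  have b2 : fn W (-1) = f₂ 1 := h.left 1 (by simp)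
  rw [integral_volI_eq_halves
    (intervalIntegrable_congr_Ioc c1 (h.sobolev_right.integrable_rpow.add
      (h.sobolev_right.intervalIntegrable_mul_rpow hp.out hU)))
    (intervalIntegrable_congr_Ioc c2 (h.sobolev_left.integrable_rpow.add
      (h.sobolev_left.intervalIntegrable_mul_rpow hp.out hU))),
    integral_congr_Ioc c1, integral_congr_Ioc c2, halfEnergy, halfEnergy, b1, b2]
  ring

theorem mass_pos {W : W1p p} (hW : W ≠ 0) : 0 < ∫ x, |fn W x| ^ p ∂volI := by
  obtain ⟨x, hx, hne⟩ : ∃ x ∈ Icc (-1 : ℝ) 1, fn W x ≠ 0 := by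
    by_contra! hcon
    exact hW (W1p_eq_zero_of_fn_eq_zero W hcon)
  rw [integral_volI]
  refine intervalIntegral.integral_pos (by norm_num)
    ((continuous_fn W).abs.rpow_const fun _ => Or.inr (by linarith [hp.out])).continuousOn
    (fun y _ => by positivity) ⟨x, hx, by positivity⟩

theorem Halves.le_rayleigh {W : W1p p} {f₁ g₁ f₂ g₂ U V : ℝ → ℝ} {α lam : ℝ}
    (h : Halves W f₁ g₁ f₂ g₂) (hU : Continuous U) (hV : IsEvenExtension V U) (hW : W ≠ 0)
    (h₁ : lam * halfMass p f₁ ≤ halfEnergy p α U f₁ g₁)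
    (h₂ : lam * halfMass p f₂ ≤ halfEnergy p α U f₂ g₂) : lam ≤ rayleigh p α V W := by
  rw [rayleigh, le_div_iff₀ (mass_pos hW), h.energy hU hV, h.mass]
  linarith

theorem Halves.rayleigh_eq {W : W1p p} {f₁ g₁ f₂ g₂ U V : ℝ → ℝ} {α lam : ℝ}
    (h : Halves W f₁ g₁ f₂ g₂) (hU : Continuous U) (hV : IsEvenExtension V U) (hW : W ≠ 0)
    (h₁ : halfEnergy p α U f₁ g₁ = lam * halfMass p f₁)
    (h₂ : halfEnergy p α U f₂ g₂ = lam * halfMass p f₂) : rayleigh p α V W = lam := by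
  rw [rayleigh, div_eq_iff (mass_pos hW).ne', h.energy hU hV, h.mass]
  linarith

theorem Halves.add {W W' : W1p p} {f g f' g' : ℝ → ℝ} (h : Halves W f g (fun _ => 0) fun _ => 0)
    (h' : Halves W' (fun _ => 0) (fun _ => 0) f' g') : Halves (W + W') f g f' g' := by
  have hd : ∀ᵐ x ∂volI, der (W + W') x = der W x + der W' x := by
    filter_upwards [Lp.coeFn_add W.1.2 W'.1.2] with x hx
    simpa [der] using hx
  obtain ⟨h1, h2⟩ := ae_of_ae_volI hd
  refine ⟨fun x hx => by rw [fn_add, h.right x hx, h'.right x hx, add_zero],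
    fun x hx => by rw [fn_add, h.left x hx, h'.left x hx, zero_add], ?_, ?_,
    h.sobolev_right, h'.sobolev_left⟩
  · filter_upwards [h1, h.der_right, h'.der_right] with x hx h1 h2 hm
    rw [hx hm, h1 hm, h2 hm, add_zero]
  · filter_upwards [h2, h.der_left, h'.der_left] with x hx h1 h2 hm
    rw [hx hm, h1 hm, h2 hm]
    ring

/-! ### Weak solutions -/

/-- An even or odd extension of an eigenfunction on `[0, 1]` solves the Robin problem. -/
theorem HalfEigen.isSolution {q α lam s : ℝ} {U V w u : ℝ → ℝ} (hpq : p.HolderConjugate q)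
    (hU : Continuous U) (hV : IsEvenExtension V U) (h : HalfEigen p q α U lam w u) (hs : |s| = 1)
    {W : W1p p} (hW : Halves W u (fun x => signedPow q (w x) * u x) (fun x => s * u x)
      fun x => s * (signedPow q (w x) * u x))
    (h0 : ∀ η : ℝ → ℝ, ContinuousOn η (Icc 0 1) → (s = -1 → η 0 = 0) →
      Tendsto (fun x => w x * u x ^ (p - 1) * η x) (𝓝[>] 0) (𝓝 0)) :
    IsSolution p α V lam W := by
  intro ξ hξ
  have hp1 : 0 < p - 1 := by linarith [hpq.lt]
  have hξd : ∀ x, HasDerivAt ξ (deriv ξ x) x := fun x =>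
    (hξ.differentiable one_ne_zero x).hasDerivAt
  have hξc := hξ.continuous
  have hξ'c : Continuous (deriv ξ) := hξ.continuous_deriv le_rfl
  -- Folding the test function at 0 reduces the weak equation on I to `HalfEigen.integral_flux`. For
  -- an odd extension η vanishes at 0, which compensates for the nonzero flux there.
  set η : ℝ → ℝ := fun x => ξ x + s * ξ (-x) with hη
  set η' : ℝ → ℝ := fun x => deriv ξ x - s * deriv ξ (-x) with hη'
  have hηc : Continuous η := by fun_prop
  have hη'c : Continuous η' := by fun_prop
  have hηd : ∀ x, HasDerivAt η (η' x) x := fun x => by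
    have := (hξd (-x)).comp x (hasDerivAt_neg x)
    convert! (hξd x).add (this.const_mul s) using 1
    simp only [hη']
    ring
  have key := h.integral_flux hpq hU hηc.continuousOn (fun x _ => hηd x)
    (hη'c.intervalIntegrable _ _) (h0 η hηc.continuousOn fun hs1 => by simp [hη, hs1])
  have c1 : ∀ᵐ x : ℝ, x ∈ Ioc (0 : ℝ) 1 →
      |der W x| ^ (p - 2) * der W x * deriv ξ x
        + (V x - lam) * (|fn W x| ^ (p - 2) * fn W x) * ξ x =
      w x * u x ^ (p - 1) * deriv ξ x + (U x - lam) * u x ^ (p - 1) * ξ x := by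
    filter_upwards [hW.der_right] with x hx hm
    have hm' := Ioc_subset_Icc_self hm
    rw [hx hm, hW.right x hm', (hV x hm').1]
    have e1 := h.signedPow_deriv hpq hm
    have e2 := signedPow_of_pos (q := p) (h.pos x hm)
    rw [signedPow] at e1 e2
    rw [e1, e2]
  have c2 : ∀ᵐ x : ℝ, x ∈ Ioc (0 : ℝ) 1 →
      |der W (-x)| ^ (p - 2) * der W (-x) * deriv ξ (-x)
        + (V (-x) - lam) * (|fn W (-x)| ^ (p - 2) * fn W (-x)) * ξ (-x) =
      w x * u x ^ (p - 1) * (-(s * deriv ξ (-x))) + (U x - lam) * u x ^ (p - 1) * (s * ξ (-x)) := by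
    filter_upwards [hW.der_left] with x hx hm
    have hm' := Ioc_subset_Icc_self hm
    rw [hx hm, hW.left x hm', (hV x hm').2]
    have e1 := h.signedPow_deriv hpq hm
    have e2 := signedPow_of_pos (q := p) (h.pos x hm)
    have e3 : signedPow p (-(s * (signedPow q (w x) * u x))) = -(s * (w x * u x ^ (p - 1))) := by
      rw [signedPow_neg, signedPow_mul_of_abs_eq_one hs, e1]
    have e4 : signedPow p (s * u x) = s * u x ^ (p - 1) := by
      rw [signedPow_mul_of_abs_eq_one hs, e2]
    rw [signedPow] at e3 e4
    rw [e3, e4]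
    ring
  obtain ⟨C, hC⟩ := h.flux_bounded
  have hu1 : ContinuousOn (fun x => u x ^ (p - 1)) (Icc 0 1) :=
    h.continuousOn_fun.rpow_const fun _ _ => Or.inr hp1.le
  have hflux : IntervalIntegrable (fun x => w x * u x ^ (p - 1)) volume 0 1 :=
    HalfEigen.intervalIntegrable_of_bounded h.continuousOn_flux hC
  have hI : ∀ {a b : ℝ → ℝ}, Continuous a → Continuous b → IntervalIntegrable
      (fun x => w x * u x ^ (p - 1) * a x + (U x - lam) * u x ^ (p - 1) * b x) volume 0 1 := by
    intro a b ha hb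
    refine (hflux.mul_continuousOn ha.continuousOn).add (ContinuousOn.intervalIntegrable ?_)
    rw [uIcc_of_le zero_le_one]
    exact ((hU.continuousOn.sub continuousOn_const).mul hu1).mul hb.continuousOn
  have i1 := hI hξ'c hξc
  have i2 := hI (a := fun x => -(s * deriv ξ (-x))) (b := fun x => s * ξ (-x)) (by fun_prop)
    (by fun_prop)
  rw [integral_volI_eq_halves (intervalIntegrable_congr_Ioc c1 i1)
    (intervalIntegrable_congr_Ioc c2 i2), integral_congr_Ioc c1, integral_congr_Ioc c2,
    ← intervalIntegral.integral_add i1 i2]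
  have e : (fun x => (w x * u x ^ (p - 1) * deriv ξ x + (U x - lam) * u x ^ (p - 1) * ξ x) +
      (w x * u x ^ (p - 1) * (-(s * deriv ξ (-x))) + (U x - lam) * u x ^ (p - 1) * (s * ξ (-x)))) =
      fun x => w x * u x ^ (p - 1) * η' x + (U x - lam) * u x ^ (p - 1) * η x := by
    funext x
    simp only [hη, hη']
    ring
  rw [e, key, hW.right 1 (by simp), hW.left 1 (by simp)]
  have e2 := signedPow_of_pos (q := p) (h.pos 1 (by simp))
  have e4 : signedPow p (s * u 1) = s * u 1 ^ (p - 1) := by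
    rw [signedPow_mul_of_abs_eq_one hs, e2]
  rw [signedPow] at e2 e4
  rw [e2, e4]
  simp only [hη]
  ring

end

/-! ### Genus -/

theorem one_le_genus {E : Type*} [TopologicalSpace E] [Neg E] {A : Set E} (hA : A.Nonempty) :
    ((0 + 1 : ℕ) : ℕ∞) ≤ genus A := by
  refine le_iInf₂ fun n ⟨h, _, _, hne⟩ => ?_
  obtain ⟨x, hx⟩ := hA
  rcases n with _ | n
  · exact absurd (Subsingleton.elim _ _) (hne x hx)
  · exact_mod_cast Nat.succ_le_succ (Nat.zero_le n)

theorem nonempty_of_one_le_genus {E : Type*} [TopologicalSpace E] [Neg E] {A : Set E}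
    (hA : ((0 + 1 : ℕ) : ℕ∞) ≤ genus A) : A.Nonempty := by
  by_contra hcon
  rw [not_nonempty_iff_eq_empty] at hcon
  subst hcon
  have h0 : HasOddMap (∅ : Set E) 0 := ⟨fun _ => 0, continuousOn_empty _, by simp, by simp⟩
  have := hA.trans (iInf₂_le 0 h0)
  simp at this

theorem exists_zero_of_two_le_genus {E : Type*} [TopologicalSpace E] [Neg E] {A : Set E}
    (hA : ((1 + 1 : ℕ) : ℕ∞) ≤ genus A) {f : E → ℝ} (hf : ContinuousOn f A)
    (hodd : ∀ x ∈ A, f (-x) = -f x) : ∃ x ∈ A, f x = 0 := by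
  by_contra! hcon
  have h1 : HasOddMap A 1 := ⟨fun x _ => f x, continuousOn_pi.2 fun _ => hf,
    fun x hx => funext fun _ => hodd x hx, fun x hx h => hcon x hx (congrFun h 0)⟩
  have := hA.trans (iInf₂_le 1 h1)
  norm_cast at this

/-- A set containing an odd loop has genus at least two. -/
theorem two_le_genus_range {E : Type*} [TopologicalSpace E] [Neg E] {γ : ℝ → E}
    (hγ : Continuous γ) (hodd : ∀ t, γ (t + Real.pi) = -γ t) :
    ((1 + 1 : ℕ) : ℕ∞) ≤ genus (range γ) := by
  refine le_iInf₂ fun n ⟨h, hc, hneg, hne⟩ => ?_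
  rcases n with _ | _ | n
  · exact absurd (Subsingleton.elim _ _) (hne (γ 0) ⟨0, rfl⟩)
  · exfalso
    have hk : Continuous fun t => h (γ t) 0 :=
      (continuous_apply 0).comp (hc.comp_continuous hγ fun t => ⟨t, rfl⟩)
    have hpi : h (γ Real.pi) 0 = -h (γ 0) 0 := by
      have := hodd 0
      rw [zero_add] at this
      rw [this, hneg _ ⟨0, rfl⟩]
      rfl
    obtain ⟨t, ht⟩ : (0 : ℝ) ∈ range fun t => h (γ t) 0 := by
      rcases le_total 0 (h (γ 0) 0) with h0 | h0
      · exact mem_range_of_exists_le_of_exists_ge hk ⟨Real.pi, by simp only [hpi]; linarith⟩ ⟨0, h0⟩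
      · exact mem_range_of_exists_le_of_exists_ge hk ⟨0, h0⟩ ⟨Real.pi, by simp only [hpi]; linarith⟩
    refine hne (γ t) ⟨t, rfl⟩ (funext fun i => ?_)
    rw [Fin.fin_one_eq_zero i]
    exact ht
  · exact_mod_cast Nat.succ_le_succ (Nat.succ_le_succ (Nat.zero_le n))

/-! ### The Ljusternik–Schnirelmann eigenvalues -/

section

variable {p : ℝ} [hp : Fact (1 < p)]

theorem W1p_neg_smul (a : ℝ) (W : W1p p) : (-a) • W = -(a • W) := neg_smul a W

theorem fn_neg (W : W1p p) (x : ℝ) : fn (-W) x = -fn W x := by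
  rw [← one_smul ℝ W, ← W1p_neg_smul, fn_smul, fn_smul]
  ring

theorem fn_zero (x : ℝ) : fn (0 : W1p p) x = 0 := by
  simpa using fn_smul 0 (0 : W1p p) x

theorem continuous_fn_zero : Continuous fun W : W1p p => fn W 0 := by
  have h0 : (0 : ℝ) ∈ Icc (-1 : ℝ) 1 := by simp
  have : (fun W : W1p p => fn W 0) = fun W : W1p p => W.1.1 ⟨0, h0⟩ := by
    funext W
    rw [fn, ext, IccExtend_of_mem _ _ h0]
  rw [this]
  exact (ContinuousEvalConst.continuous_eval_const _).comp
    (continuous_fst.comp continuous_subtype_val)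

theorem ne_zero_of_fn_ne_zero {W : W1p p} {x : ℝ} (h : fn W x ≠ 0) : W ≠ 0 := by
  rintro rfl
  exact h (fn_zero x)

/-- The even extension W attains lam on the admissible set `{W, -W}`. Conversely, the Neumann
problem imposes no condition at 0, so its lower bound holds on both halves of any Sobolev function.
-/
theorem eigenvalue_zero_of_neumannRiccati {q α lam : ℝ} {U V w : ℝ → ℝ}
    (hpq : p.HolderConjugate q) (hU : Continuous U) (hV : IsEvenExtension V U)
    (h : NeumannRiccati p q α U lam w) :
    eigenvalue p α V 0 = lam ∧ IsEigenvalue p α V lam := by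
  obtain ⟨u, hu, -⟩ := h.exists_halfEigen hpq
  have hs := hu.halfSobolev hpq
  obtain ⟨W, hW⟩ := exists_halves hs hs rfl
  have hW0 : W ≠ 0 := ne_zero_of_fn_ne_zero (x := 1)
    (by rw [hW.right 1 (by simp)]; exact (hu.pos 1 (by simp)).ne')
  have hE := hu.halfEnergy_eq hpq hU (hu.tendsto_flux_mul_of_neumann hpq h hu.continuousOn_fun)
  have hneg := hW.smul (-1)
  rw [W1p_neg_smul, one_smul] at hneg
  have hR : rayleigh p α V W = lam := hW.rayleigh_eq hU hV hW0 hE hE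
  have hR' : rayleigh p α V (-W) = lam := by
    have : halfEnergy p α U (fun x => -1 * u x) (fun x => -1 * (signedPow q (w x) * u x)) =
        lam * halfMass p (fun x => -1 * u x) := by
      rw [halfEnergy_const_mul, halfMass_const_mul, hE]
      ring
    exact hneg.rayleigh_eq hU hV (neg_ne_zero.2 hW0) this this
  constructor
  · refine IsLeast.csInf_eq ⟨⟨{W, -W}, ⟨?_, ?_, ?_, one_le_genus ⟨W, by simp⟩⟩, ?_⟩, ?_⟩
    · exact (Set.toFinite _).isCompact
    · rintro x (rfl | rfl) <;> simp
    · rintro (h0 | h0)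
      · exact hW0 h0.symm
      · exact neg_ne_zero.2 hW0 h0.symm
    · constructor
      · exact ⟨W, by simp, hR⟩
      · rintro _ ⟨x, (rfl | rfl), rfl⟩
        exacts [hR.le, hR'.le]
    · rintro c ⟨A, ⟨-, -, hA0, hA⟩, hc⟩
      obtain ⟨x, hx⟩ := nonempty_of_one_le_genus hA
      have hx0 : x ≠ 0 := by
        rintro rfl
        exact hA0 hx
      have hh := halves_self x
      exact (hh.le_rayleigh hU hV hx0 (h.mul_halfMass_le hpq hU hh.sobolev_right)
        (h.mul_halfMass_le hpq hU hh.sobolev_left)).trans (hc.2 ⟨x, hx, rfl⟩)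
  · refine ⟨W, hW0, hu.isSolution (s := 1) hpq hU hV (by simp) (by simpa using hW)
      fun η hη _ => hu.tendsto_flux_mul_of_neumann hpq h hη⟩

theorem eigenvalue_one_of_dirichletRiccati {q α lam : ℝ} {U V w : ℝ → ℝ}
    (hpq : p.HolderConjugate q) (hU : Continuous U) (hV : IsEvenExtension V U)
    (h : DirichletRiccati p q α U lam w) :
    eigenvalue p α V 1 = lam ∧ IsEigenvalue p α V lam := by
  obtain ⟨v, hv, hv0⟩ := h.exists_halfEigen hpq hU
  have hs := hv.halfSobolev hpq
  have hE := hv.halfEnergy_eq hpq hU (hv.tendsto_flux_mul_of_apply_zero hv.continuousOn_fun hv0)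
  have hv1 := (hv.pos 1 (by simp)).ne'
  obtain ⟨Wr, hWr⟩ := exists_halves hs HalfSobolev.zero hv0
  obtain ⟨Wl, hWl⟩ := exists_halves HalfSobolev.zero hs hv0.symm
  -- The two pieces live on opposite halves, so energy and mass are both multiplied by `|cos t|^p +
  -- |sin t|^p` and the Rayleigh quotient is constant along the loop.
  set γ : ℝ → W1p p := fun t => Real.cos t • Wr + Real.sin t • Wl with hγ
  have hγh : ∀ t, Halves (γ t) (fun x => Real.cos t * v x)
      (fun x => Real.cos t * (signedPow q (w x) * v x)) (fun x => Real.sin t * v x)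
      (fun x => Real.sin t * (signedPow q (w x) * v x)) := fun t => by
    have h1 := hWr.smul (Real.cos t)
    have h2 := hWl.smul (Real.sin t)
    simp only [mul_zero] at h1 h2
    exact h1.add h2
  have hγ0 : ∀ t, γ t ≠ 0 := by
    intro t
    by_cases hc : Real.cos t = 0
    · have hsin : Real.sin t ≠ 0 := fun hsin => by
        have := Real.sin_sq_add_cos_sq t
        simp [hc, hsin] at this
      refine ne_zero_of_fn_ne_zero (x := -1) ?_
      rw [(hγh t).left 1 (by simp)]
      exact mul_ne_zero hsin hv1
    · refine ne_zero_of_fn_ne_zero (x := 1) ?_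
      rw [(hγh t).right 1 (by simp)]
      exact mul_ne_zero hc hv1
  have hscale : ∀ a : ℝ, halfEnergy p α U (fun x => a * v x)
      (fun x => a * (signedPow q (w x) * v x)) = lam * halfMass p (fun x => a * v x) := fun a => by
    rw [halfEnergy_const_mul, halfMass_const_mul, hE]
    ring
  have hR : ∀ t, rayleigh p α V (γ t) = lam := fun t =>
    (hγh t).rayleigh_eq hU hV (hγ0 t) (hscale _) (hscale _)
  have hγc : Continuous γ := (Real.continuous_cos.smul continuous_const).add
    (Real.continuous_sin.smul continuous_const)
  have hγodd : ∀ t, γ (t + Real.pi) = -γ t := fun t => by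
    simp only [hγ, Real.cos_add_pi, Real.sin_add_pi, W1p_neg_smul, neg_add]
  have hper : Function.Periodic γ (2 * Real.pi) := fun t => by
    simp only [hγ, Real.cos_add_two_pi, Real.sin_add_two_pi]
  constructor
  · refine IsLeast.csInf_eq ⟨⟨range γ, ⟨hper.compact_of_continuous Real.two_pi_pos.ne' hγc, ?_, ?_,
      two_le_genus_range hγc hγodd⟩, ?_⟩, ?_⟩
    · rintro _ ⟨t, rfl⟩
      exact ⟨t + Real.pi, hγodd t⟩
    · rintro ⟨t, ht⟩
      exact hγ0 t ht
    · constructor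
      · exact ⟨γ 0, ⟨0, rfl⟩, hR 0⟩
      · rintro _ ⟨_, ⟨t, rfl⟩, rfl⟩
        exact (hR t).le
    · rintro c ⟨A, ⟨-, -, hA0, hA⟩, hc⟩
      -- Evaluation at 0 is odd and continuous, so it vanishes somewhere on A; both halves of that
      -- function satisfy the Dirichlet condition.
      obtain ⟨x, hx, hfx⟩ := exists_zero_of_two_le_genus hA
        continuous_fn_zero.continuousOn fun W _ => fn_neg W 0
      have hx0 : x ≠ 0 := by
        rintro rfl
        exact hA0 hx
      have hh := halves_self x
      exact (hh.le_rayleigh hU hV hx0 (h.mul_halfMass_le _ _ hh.sobolev_right hfx)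
        (h.mul_halfMass_le _ _ hh.sobolev_left (by simpa using hfx))).trans (hc.2 ⟨x, hx, rfl⟩)
  · obtain ⟨W, hW⟩ := exists_halves hs (hs.const_mul (a := -1)) (by simp [hv0])
    refine ⟨W, ne_zero_of_fn_ne_zero (x := 1) (by rw [hW.right 1 (by simp)]; exact hv1),
      hv.isSolution (s := -1) hpq hU hV (by simp) hW
      fun η hη hη0 => hv.tendsto_flux_mul_of_apply_zero hη (hη0 rfl)⟩

end

/-! ### Symmetric single-well potentials -/

/-- If the bottom x₀ is positive, reflecting the non-increasing branch shows that V is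
non-decreasing on `(-x₀, 1)`, which contains `(0, 1)`. The endpoints follow by continuity. -/
theorem monotoneOn_of_isSingleWell {V : ℝ → ℝ} (hV : ContinuousOn V (Icc (-1) 1))
    (hsymm : IsSymmetric V) (hwell : IsSingleWell V) : MonotoneOn V (Icc 0 1) := by
  obtain ⟨x₀, hx₀, hanti, hmono⟩ := hwell
  have hIoo : MonotoneOn V (Ioo 0 1) := by
    rcases le_total x₀ 0 with h | h
    · exact hmono.mono (Ioo_subset_Ioo_left h)
    · have hmono' : MonotoneOn V (Ioo (-x₀) 1) := by
        intro x hx y hy hxy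
        have := hanti (a := -y) (b := -x) ⟨by linarith [hy.2], by linarith [hy.1]⟩
          ⟨by linarith [hx.2], by linarith [hx.1]⟩ (by linarith)
        rwa [hsymm x ⟨by linarith [hx.1, hx₀.2], hx.2.le⟩,
          hsymm y ⟨by linarith [hy.1, hx₀.2], hy.2.le⟩] at this
      exact hmono'.mono (Ioo_subset_Ioo_left (by linarith))
  have hc : ContinuousOn V (Icc 0 1) := hV.mono (Icc_subset_Icc_left (by norm_num))
  intro x hx y hy hxy
  rcases hxy.eq_or_lt with rfl | hlt
  · exact le_rfl
  have hsub : Ioo x y ⊆ Ioo 0 1 := Ioo_subset_Ioo hx.1 hy.2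
  have hx' : Tendsto V (𝓝[Ioo x y] x) (𝓝 (V x)) :=
    (hc x hx).mono_left (nhdsWithin_mono _ (hsub.trans Ioo_subset_Icc_self))
  have hy' : Tendsto V (𝓝[Ioo x y] y) (𝓝 (V y)) :=
    (hc y hy).mono_left (nhdsWithin_mono _ (hsub.trans Ioo_subset_Icc_self))
  rw [nhdsWithin_Ioo_eq_nhdsGT hlt] at hx'
  rw [nhdsWithin_Ioo_eq_nhdsLT hlt] at hy'
  refine ge_of_tendsto hy' ?_
  filter_upwards [Ioo_mem_nhdsLT hlt] with t ht
  refine le_of_tendsto hx' ?_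
  filter_upwards [Ioo_mem_nhdsGT ht.1] with r hr
  exact hIoo (hsub ⟨hr.1, hr.2.trans ht.2⟩) (hsub ht) hr.2.le

end RobinGap

end

/-! ### Transfer from the half interval to I -/

theorem theorem1 (p : ℝ) [Fact (1 < p)] (α : ℝ) (V : ℝ → ℝ)
    (hV : ContinuousOn V (Set.Icc (-1) 1))
    (hsymm : RobinGap.IsSymmetric V) (hwell : RobinGap.IsSingleWell V) :
    RobinGap.IsEigenvalue p α V (RobinGap.eigenvalue p α V 0) ∧
    RobinGap.IsEigenvalue p α V (RobinGap.eigenvalue p α V 1) ∧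
    RobinGap.gap p α (fun _ => 0) ≤ RobinGap.gap p α V ∧
    (RobinGap.gap p α V = RobinGap.gap p α (fun _ => 0) →
      ∃ c : ℝ, ∀ x ∈ Set.Icc (-1 : ℝ) 1, V x = c) := by
  have hp : 1 < p := Fact.out
  have hpq := Real.HolderConjugate.conjExponent hp
  have hm := RobinGap.monotoneOn_of_isSingleWell hV hsymm hwell
  have hV01 : ContinuousOn V (Set.Icc 0 1) := hV.mono (Set.Icc_subset_Icc_left (by norm_num))
  -- V is controlled only on `[-1, 1]`, whereas the half-interval results ask for a potential
  -- continuous on the whole line; U continues V from `[0, 1]` by constants.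
  set U : ℝ → ℝ := Set.IccExtend (zero_le_one : (0 : ℝ) ≤ 1) ((Set.Icc 0 1).domRestrict V) with hU
  have hUc : Continuous U := hV01.domRestrict.Icc_extend'
  have hUV : ∀ x ∈ Set.Icc (0 : ℝ) 1, U x = V x := fun x hx => by
    rw [hU, Set.IccExtend_of_mem _ _ hx]
    rfl
  have hVU : RobinGap.IsEvenExtension V U := fun x hx =>
    ⟨(hUV x hx).symm, by rw [hUV x hx, hsymm x ⟨by linarith [hx.1], hx.2⟩]⟩
  have hUm : MonotoneOn U (Set.Icc 0 1) := fun x hx y hy hxy => by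
    rw [hUV x hx, hUV y hy]
    exact hm hx hy hxy
  obtain ⟨l₀, l₁, l₀', l₁', ⟨_, h₀⟩, ⟨_, h₁⟩, ⟨_, h₀'⟩, ⟨_, h₁'⟩, hle, heq⟩ :=
    RobinGap.exists_gap_le hpq α hUc hUm
  have hzero : RobinGap.IsEvenExtension (fun _ => 0) (fun _ => 0) := fun _ _ => ⟨rfl, rfl⟩
  obtain ⟨e₀, -⟩ := RobinGap.eigenvalue_zero_of_neumannRiccati hpq continuous_const hzero h₀
  obtain ⟨e₁, -⟩ := RobinGap.eigenvalue_one_of_dirichletRiccati hpq continuous_const hzero h₁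
  obtain ⟨e₀', i₀⟩ := RobinGap.eigenvalue_zero_of_neumannRiccati hpq hUc hVU h₀'
  obtain ⟨e₁', i₁⟩ := RobinGap.eigenvalue_one_of_dirichletRiccati hpq hUc hVU h₁'
  simp only [RobinGap.gap, e₀, e₁, e₀', e₁']
  refine ⟨i₀, i₁, hle, fun h => ?_⟩
  have h01 := heq h.symm
  rw [hUV 0 (by simp), hUV 1 (by simp)] at h01
  have hconst : ∀ x ∈ Set.Icc (0 : ℝ) 1, V x = V 0 := fun x hx =>
    le_antisymm (h01 ▸ hm hx (by simp) hx.2) (hm (by simp) hx hx.1)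
  refine ⟨V 0, fun x hx => ?_⟩
  rcases le_total 0 x with h0 | h0
  · exact hconst x ⟨h0, hx.2⟩
  · rw [← hsymm x hx]
    exact hconst (-x) ⟨by linarith, by linarith [hx.1]⟩
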